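/- **Setting.** For even $n\ge 0$ let $B_n=\{z\in\{0,1\}^{n+1} : |z|>n/2\}$, where $|\cdot|$ is Hamming weight, and define $\psi:\{0,1\}^n\to\{0,1\}^{n+1}$ as follows. Given $x\in\{0,1\}^n$, repeatedly choose two coordinates $i<j$, both unmarked, with all coordinates strictly between them already marked, and with $x_i=1$, $x_j=0$, and mark both of them; stop when there is no such pair (the set of marked coordinates at the end does not depend on the choices). Let $y\in\{0,1,\sqcup\}^n$ be obtained from $x$ by replacing every unmarked bit by $\sqcup$, let $m$ be the number of symbols $\sqcup$ in $y$ and $k=(n-m)/2$. For $k\le r\le n-k$ let $c_r\in\{0,1\}^n$ be obtained from $y$ by replacing the $m-(r-k)$ leftmost symbols $\sqcup$ by $0$ and the other $r-k$ by $1$; then $|c_r|=r$ and $x=c_j$ for $j=|x|$. Put $$\psi(x)=\begin{cases} c_{((n-k)+j)/2}\circ 1 & \text{if } j\equiv n-k \pmod 2,\\ c_{((n-k)+j+1)/2}\circ 0 & \text{otherwise,}\end{cases}$$ where $\circ$ denotes concatenation. **Complexity class.** A family of partial functions $f_N:\{0,1\}^N\to\{0,1\}^{\ell(N)}$, $N\ge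 0$, is computable in DLOGTIME-uniform $\mathrm{TC}^0$ if there are circuits $(C_N)_{N\ge 0}$, $C_N$ having $N$ input bits and $\ell(N)$ output bits and consisting of NOT gates and of AND, OR and MAJORITY gates of unbounded fan-in, with size polynomial in $N$ and depth bounded by a constant, such that $C_N(x)=f_N(x)$ whenever $f_N(x)$ is defined, and such that the family is DLOGTIME-uniform: the nodes of $C_N$ can be given distinct names, bit strings of length $O(\log N)$ (read as $O(1)$ for $N\le 1$), so that a deterministic multitape Turing machine, given $N$ in binary together with one of the questions "is $a$ a gate of type $t$?", "is $a$ the node of the $i$-th input bit?", "is $a$ the node of the $i$-th output bit?", "is $b$ a child of $a$?" about $C_N$ (where $a,b$ are bit strings and $i$ is written in binary), answers it in time linear in the length of the question, that is, in time $O(\log N)$ for questions of length $O(\log N)$. **Proposition.** For every even $n$ the map $\psi$ is a bijection from $\{0,1\}^n$ onto $B_n$. Moreover, the bijections $\psi$ (from $\{0,1\}^n$ to $B_n$, for all even $n$) and $\psi^{-1}$ (from $B_n$ to $\{0,1\}^n$, for all even $n$) are computable in DLOGTIME-uniform $\mathrm{TC}^0$. -/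

import Mathlib

/-! ### The bijection from the cube to the Hamming ball

Bits are Booleans (`true` is 1, `false` is 0); the cube `{0,1}ⁿ` is `Fin n → Bool`. -/

namespace CubeBall

/-- The Hamming weight `|x|`. -/
def weight {n : ℕ} (x : Fin n → Bool) : ℕ :=
  (Finset.univ.filter fun i => x i = true).card

/-- The Hamming ball `{z ∈ {0,1}^(n+1) : |z| > n/2}`. -/
def ball (n : ℕ) : Set (Fin (n + 1) → Bool) :=
  {z | n < 2 * weight z}

/-- One step of the marking stage on `x`. `M` is the set of coordinates marked so far; these are
temporarily deleted, so a `1` at `i` and a `0` at `j` are consecutive when everything strictly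
between `i` and `j` has been marked. -/
def MarkStep {n : ℕ} (x : Fin n → Bool) (M M' : Finset (Fin n)) : Prop :=
  ∃ i j : Fin n, i < j ∧ i ∉ M ∧ j ∉ M ∧ (∀ k, i < k → k < j → k ∈ M) ∧
    x i = true ∧ x j = false ∧ M' = insert i (insert j M)

/-- `M` is the set of marked coordinates at the end of some complete run of the marking stage. -/
def IsMarking {n : ℕ} (x : Fin n → Bool) (M : Finset (Fin n)) : Prop :=
  Relation.ReflTransGen (MarkStep x) ∅ M ∧ ∀ M', ¬ MarkStep x M M'

theorem exists_isMarking {n : ℕ} (x : Fin n → Bool) : ∃ M, IsMarking x M := by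
  classical
  let S : Finset (Finset (Fin n)) :=
    Finset.univ.filter fun M => Relation.ReflTransGen (MarkStep x) ∅ M
  have hS : S.Nonempty := ⟨∅, by simp [S, Relation.ReflTransGen.refl]⟩
  obtain ⟨M, hM, hmax⟩ := S.exists_max_image Finset.card hS
  have hM' : Relation.ReflTransGen (MarkStep x) ∅ M := by simpa [S] using hM
  refine ⟨M, hM', fun M' h => ?_⟩
  have hle := hmax M' (by simpa [S] using hM'.tail h)
  obtain ⟨i, j, hij, hi, hj, -, -, -, rfl⟩ := h
  have h1 : i ∉ insert j M := by simp [hij.ne, hi]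
  rw [Finset.card_insert_of_notMem h1, Finset.card_insert_of_notMem hj] at hle
  omega

/-- The marked coordinates of `x`: the outcome of a complete run of the marking stage. (The
outcome is the same for all runs; nothing below presupposes this.) -/
noncomputable def marked {n : ℕ} (x : Fin n → Bool) : Finset (Fin n) :=
  (exists_isMarking x).choose

theorem marked_spec {n : ℕ} (x : Fin n → Bool) : IsMarking x (marked x) :=
  (exists_isMarking x).choose_spec

/-- The string over `{0, 1, ⊔}` that encodes the chain containing `x`: a marked coordinate keeps
its bit, an unmarked one becomes the blank symbol `⊔`, here `none`. -/
noncomputable def code {n : ℕ} (x : Fin n → Bool) : Fin n → Option Bool :=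
  fun i => if i ∈ marked x then some (x i) else none

/-- The number `m` of blanks of `y`. -/
def blanks {n : ℕ} (y : Fin n → Option Bool) : ℕ :=
  (Finset.univ.filter fun i => y i = none).card

/-- The chain encoded by `y` is `c_k, c_{k+1}, …, c_{n-k}` with `k = (n - m) / 2`. -/
def bottom {n : ℕ} (y : Fin n → Option Bool) : ℕ :=
  (n - blanks y) / 2

/-- The element `c_r` of the chain encoded by `y`, for `k ≤ r ≤ n - k`: the `m - (r - k)`
leftmost blanks are replaced by `0` and the remaining blanks by `1`. -/
def chain {n : ℕ} (y : Fin n → Option Bool) (r : ℕ) : Fin n → Bool := fun i =>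
  match y i with
  | some b => b
  | none =>
    decide (blanks y - (r - bottom y) ≤ (Finset.univ.filter fun l => l < i ∧ y l = none).card)

/-- The mapping `ψ`. The index `j` with `x = c_j` in its chain is `|x|`, because `c_j` has
weight `j`; `t = n - k` is the index of the top of the chain. -/
noncomputable def psi (n : ℕ) (x : Fin n → Bool) : Fin (n + 1) → Bool :=
  let y := code x
  let t := n - bottom y
  let j := weight x
  if j % 2 = t % 2 then Fin.snoc (chain y ((t + j) / 2)) true
  else Fin.snoc (chain y ((t + j + 1) / 2)) false

/-- The inverse mapping `ψ⁻¹`, to be applied to elements of the ball. -/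
noncomputable def psiInv (n : ℕ) (z : Fin (n + 1) → Bool) : Fin n → Bool :=
  Function.invFun (psi n) z

/-- `ψ` as a family of partial functions, indexed by the input length `N`; it is defined for
even `N`. -/
noncomputable def psiFamily (N : ℕ) : (Fin N → Bool) →. (Fin (N + 1) → Bool) :=
  fun x => ⟨Even N, fun _ => psi N x⟩

/-- `ψ⁻¹` as a family of partial functions, indexed by the input length `N = n + 1`; it is
defined for even `n`, on the ball in `{0,1}^(n+1)`. -/
noncomputable def psiInvFamily : (N : ℕ) → (Fin N → Bool) →. (Fin (N - 1) → Bool)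
  | 0 => fun _ => Part.none
  | n + 1 => fun z => ⟨Even n ∧ z ∈ ball n, fun _ => psiInv n z⟩

end CubeBall

/-! ### Threshold circuits and DLOGTIME-uniform TC⁰ -/

namespace ThresholdCircuit

/-- The types of the logical gates. -/
inductive GateType
  | and | or | not | maj
  deriving DecidableEq

instance : Fintype GateType :=
  ⟨{GateType.and, GateType.or, GateType.not, GateType.maj}, fun t => by cases t <;> simp⟩

/-- The label of a node of a circuit with `n` input bits. -/
inductive Label (n : ℕ)
  | input (i : Fin n)
  | gate (t : GateType)

/-- The value of a gate with `k` children, `s` of which have value 1 (`not` gates have exactly one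
child). A majority gate outputs 1 when more than half of its children have value 1. -/
def GateType.value (s k : ℕ) : GateType → Bool
  | and => decide (s = k)
  | or => decide (0 < s)
  | not => decide (s = 0)
  | maj => decide (k < 2 * s)

def Label.value {n : ℕ} (x : Fin n → Bool) (s k : ℕ) : Label n → Bool
  | input i => x i
  | gate t => t.value s k

/-- Circuits with `n` input bits and `m` output bits over negations and AND, OR and MAJORITY
gates of unbounded fan-in: finite acyclic directed graphs with labelled nodes. -/
structure Circuit (n m : ℕ) where
  Gate : Type
  [fintypeGate : Fintype Gate]
  label : Gate → Label n
  children : Gate → Finset Gate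
  output : Fin m → Gate
  children_input : ∀ g i, label g = Label.input i → children g = ∅
  card_children_not : ∀ g, label g = Label.gate GateType.not → (children g).card = 1
  acyclic : WellFounded fun h g => h ∈ children g

attribute [instance] Circuit.fintypeGate

namespace Circuit

variable {n m : ℕ} (C : Circuit n m)

/-- The size: the number of nodes. -/
def size : ℕ := Fintype.card C.Gate

/-- The value of a node on input `x`. -/
noncomputable def eval (x : Fin n → Bool) : C.Gate → Bool :=
  C.acyclic.fix fun g val =>
    (C.label g).value x
      ((C.children g).attach.filter fun h => val h.1 h.2 = true).card (C.children g).card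

theorem eval_eq (x : Fin n → Bool) (g : C.Gate) :
    C.eval x g = (C.label g).value x
      ((C.children g).filter fun h => C.eval x h = true).card (C.children g).card := by
  unfold eval
  rw [WellFounded.fix_eq]
  congr 1
  conv_rhs => rw [← Finset.attach_map_val (s := C.children g), Finset.filter_map,
    Finset.card_map]
  rfl

/-- The length of a longest path that leads from a leaf to the node. -/
noncomputable def height : C.Gate → ℕ :=
  C.acyclic.fix fun g ht => (C.children g).attach.sup fun h => ht h.1 h.2 + 1

theorem height_eq (g : C.Gate) :
    C.height g = (C.children g).sup fun h => C.height h + 1 := by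
  unfold height
  rw [WellFounded.fix_eq]
  exact Finset.sup_attach (C.children g) fun h => C.height h + 1

/-- The depth: the length of a longest path. -/
noncomputable def depth : ℕ := Finset.univ.sup C.height

/-- The function that the circuit computes. -/
noncomputable def compute (x : Fin n → Bool) : Fin m → Bool :=
  fun j => C.eval x (C.output j)

end Circuit

/-- Questions about one circuit whose nodes are named by bit strings. -/
inductive Question
  /-- Is `a` a gate of type `t`? -/
  | gate (t : GateType) (a : List Bool)
  /-- Is `a` an input node that reads the input bit number `i`? -/
  | input (a : List Bool) (i : ℕ)
  /-- Is `a` the node of the output bit number `j`? -/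
  | output (a : List Bool) (j : ℕ)
  /-- Is `b` a child of `a`? -/
  | wire (a b : List Bool)

/-- The alphabet in which queries are written. -/
inductive Sym
  | bit (b : Bool) | gate (t : GateType) | input | output | wire | sep
  deriving DecidableEq, Fintype

/-- A bit string as a word over the alphabet of queries. -/
def bits (a : List Bool) : List Sym := a.map Sym.bit

/-- The word for a question; numbers are written in binary. -/
def Question.encode : Question → List Sym
  | gate t a => Sym.gate t :: bits a
  | input a i => Sym.input :: (bits a ++ Sym.sep :: bits (Computability.encodeNat i))
  | output a j => Sym.output :: (bits a ++ Sym.sep :: bits (Computability.encodeNat j))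
  | wire a b => Sym.wire :: (bits a ++ Sym.sep :: bits b)

/-- A query to a circuit family: a question about the circuit number `N`. -/
structure Query where
  N : ℕ
  question : Question

/-- The word for a query; the index `N` is written in binary. -/
def Query.encode (q : Query) : List Sym :=
  bits (Computability.encodeNat q.N) ++ q.question.encode

/-- The true answers to the questions about a circuit `C` whose nodes are named by `name`. -/
def Question.Holds {n m : ℕ} (C : Circuit n m) (name : C.Gate → List Bool) : Question → Prop
  | gate t a => ∃ g, name g = a ∧ C.label g = Label.gate t
  | input a i => ∃ g, name g = a ∧ ∃ k : Fin n, (k : ℕ) = i ∧ C.label g = Label.input k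
  | output a j => ∃ k : Fin m, (k : ℕ) = j ∧ name (C.output k) = a
  | wire a b => ∃ g h, name g = a ∧ name h = b ∧ h ∈ C.children g

/-- The direct connection language of a circuit family with named nodes, as a decision problem. -/
noncomputable def directConnection {out : ℕ → ℕ} (C : (N : ℕ) → Circuit N (out N))
    (name : (N : ℕ) → (C N).Gate → List Bool) (q : Query) : Bool :=
  open Classical in decide (q.question.Holds (C q.N) (name q.N))

/-- DLOGTIME-uniformity: the nodes of the `N`-th circuit can be given distinct names of
`O(log N)` bits such that a deterministic multitape Turing machine (Mathlib's multistack model)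
decides the direct connection language in time linear in the length of the query, that is in
time `O(log N)`, since both the names and the index `N`, in binary, have length `O(log N)`. -/
def DLogTimeUniform {out : ℕ → ℕ} (C : (N : ℕ) → Circuit N (out N)) : Prop :=
  ∃ name : (N : ℕ) → (C N).Gate → List Bool,
    (∀ N, Function.Injective (name N)) ∧
    (∃ c : ℕ, ∀ N g, (name N g).length ≤ c * (Nat.log 2 N + 1)) ∧
    ∃ (T : Turing.TM2ComputableInTime Query.encode Computability.encodeBool
        (directConnection C name)) (c : ℕ),
      ∀ l, T.time l ≤ c * (l + 1)

/-- The family `f` of partial functions `{0,1}^N → {0,1}^(out N)` is computable in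
DLOGTIME-uniform TC⁰: a DLOGTIME-uniform family of threshold circuits of polynomial size and
constant depth computes `f N` wherever it is defined. -/
def InUniformTC0 (out : ℕ → ℕ) (f : (N : ℕ) → (Fin N → Bool) →. (Fin (out N) → Bool)) : Prop :=
  ∃ C : (N : ℕ) → Circuit N (out N),
    (∃ c : ℕ, ∀ N, (C N).size ≤ N ^ c + c) ∧
    (∃ d : ℕ, ∀ N, (C N).depth ≤ d) ∧
    DLogTimeUniform C ∧
    ∀ N x y, y ∈ f N x → (C N).compute x = y

end ThresholdCircuit

namespace CubeBall

/-! ### Counting on intervals -/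

/-! The marked coordinates form nested pairs 1…0, and the unmarked bits read 0…01…1. Hence `j` is an
unmarked zero exactly when every interval ending at `j` has more zeros than ones, and `i` is an
unmarked one exactly when every interval starting at `i` has more ones than zeros
(`IsSplit.free_zero_iff`, `IsSplit.free_one_iff`). This shows that the marking does not depend on
the run, and it expresses the marking by majorities over intervals.

The elements of a chain share their marked set (`marked_fill`) and differ only in the number of
unmarked zeros. If x has f of them, then ψ(x) consists of the chain element with ⌊f/2⌋ of them and
of a bit b that is 1 iff f is even (`psi_eq`). So f = 2z + (1 - b), where z is the number of
unmarked zeros in the first n bits of ψ(x), and ψ is injective. For a string with last bit b whose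
first n bits have z unmarked zeros and o unmarked ones, lying in the ball means z < o + 2b, while
having a preimage needs 2z + 1 - b ≤ z + o. For even n the number z + o is even, and the two
conditions agree.

Bitwise, ψ raises those unmarked zeros that have at least as many unmarked zeros before them as
after them, and appends 1 unless some unmarked zero is exactly in the middle (`one_psi_iff`,
`psi_last_iff`). The inverse lowers the first z + 1 - b unmarked ones (`one_unpsi_iff`). These
comparisons of counts are single majority gates padded with constants, so constant depth suffices.

For uniformity, the nodes are triples (p, q, k) with p, q ≤ N and k < 16, and all connections are
Boolean combinations of conditions v + c ≤ v' and v = c. A name interleaves the binary digits of p,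
q and k. A finite automaton that reads the index and the names in parallel, least significant digit
first, decides such conditions by remembering a bounded carry (`Formula.isRegular`). A multistack
machine brings the words of a query into alignment and runs the automaton in linear time
(`exists_linearTime_machine`). -/

open Classical in
/-- The number of `i` with `a ≤ i < b` and `P i`. -/
noncomputable def cnt (P : ℕ → Prop) (a b : ℕ) : ℕ := ((Finset.Ico a b).filter P).card

section cnt

variable {P Q R : ℕ → Prop} {a b c : ℕ}

theorem cnt_self : cnt P a a = 0 := by simp [cnt]

open Classical in
theorem cnt_succ (h : a ≤ b) : cnt P a (b + 1) = cnt P a b + if P b then 1 else 0 := by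
  unfold cnt
  rw [← Finset.insert_Ico_right_eq_Ico_add_one h, Finset.filter_insert]
  split
  · rw [Finset.card_insert_of_notMem (by simp)]
  · rfl

theorem cnt_add (h : a ≤ b) (h' : b ≤ c) : cnt P a b + cnt P b c = cnt P a c := by
  classical
  unfold cnt
  rw [← Finset.Ico_union_Ico_eq_Ico h h', Finset.filter_union, Finset.card_union_of_disjoint]
  exact Finset.disjoint_filter_filter (Finset.Ico_disjoint_Ico_consecutive a b c)

theorem cnt_congr (h : ∀ i, a ≤ i → i < b → (P i ↔ Q i)) : cnt P a b = cnt Q a b := by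
  classical
  unfold cnt
  congr 1
  exact Finset.filter_congr fun i hi => h i (Finset.mem_Ico.1 hi).1 (Finset.mem_Ico.1 hi).2

theorem cnt_mono (h : ∀ i, a ≤ i → i < b → P i → Q i) : cnt P a b ≤ cnt Q a b := by
  classical
  unfold cnt
  refine Finset.card_le_card fun i hi => ?_
  simp only [Finset.mem_filter, Finset.mem_Ico] at hi ⊢
  exact ⟨hi.1, h i hi.1.1 hi.1.2 hi.2⟩

theorem cnt_or (h : ∀ i, a ≤ i → i < b → (R i ↔ P i ∨ Q i))
    (h' : ∀ i, a ≤ i → i < b → P i → ¬ Q i) : cnt R a b = cnt P a b + cnt Q a b := by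
  classical
  rw [cnt_congr h]
  unfold cnt
  rw [← Finset.card_union_of_disjoint]
  · congr 1
    ext i
    simp only [Finset.mem_filter, Finset.mem_union]
    tauto
  · rw [Finset.disjoint_filter]
    intro i hi
    exact h' i (Finset.mem_Ico.1 hi).1 (Finset.mem_Ico.1 hi).2

theorem cnt_true (h : ∀ i, a ≤ i → i < b → P i) : cnt P a b = b - a := by
  rw [cnt_congr (Q := fun _ => True) fun i h1 h2 => iff_true_intro (h i h1 h2)]
  simp [cnt]

theorem cnt_false (h : ∀ i, a ≤ i → i < b → ¬ P i) : cnt P a b = 0 := by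
  rw [cnt_congr (Q := fun _ => False) fun i h1 h2 => iff_false_intro (h i h1 h2)]
  simp [cnt]

theorem cnt_succ_of (h : a ≤ b) (hb : P b) : cnt P a (b + 1) = cnt P a b + 1 := by
  rw [cnt_succ h, if_pos hb]

theorem cnt_succ_of_not (h : a ≤ b) (hb : ¬ P b) : cnt P a (b + 1) = cnt P a b := by
  rw [cnt_succ h, if_neg hb, add_zero]

open Classical in
theorem cnt_insert (h : ∀ l, Q l ↔ P l ∨ l = c) (hc : ¬ P c) (t : ℕ) :
    cnt Q 0 t = cnt P 0 t + if c < t then 1 else 0 := by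
  induction t with
  | zero => simp [cnt_self]
  | succ t ih =>
    rw [cnt_succ (Nat.zero_le t), cnt_succ (Nat.zero_le t), ih]
    by_cases h1 : t = c
    · subst h1; simp [h, hc]
    · have h2 : t < c ∨ c < t := by omega
      rcases h2 with h2 | h2
      · simp [h, h1, show ¬ c < t by omega, show ¬ c < t + 1 by omega]
      · simp [h, h1, h2, show c < t + 1 by omega]; omega

/-- The count grows by one exactly at the elements of `P`, so each value below the total is the rank
of an element. This supplies the middle unmarked zero in `psi_last_iff`. -/
theorem exists_cnt_eq {s t : ℕ} (h : s < cnt P 0 t) : ∃ i < t, P i ∧ cnt P 0 i = s := by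
  induction t with
  | zero => simp [cnt_self] at h
  | succ t ih =>
    by_cases h1 : s < cnt P 0 t
    · obtain ⟨i, hi, h2⟩ := ih h1
      exact ⟨i, by omega, h2⟩
    · by_cases h2 : P t
      · rw [cnt_succ_of (Nat.zero_le t) h2] at h
        exact ⟨t, by omega, h2, by omega⟩
      · rw [cnt_succ_of_not (Nat.zero_le t) h2] at h
        omega

/-- Used to count the zeros that refilling writes: they occupy the first `s` unmarked positions. -/
theorem cnt_rank_lt (s t : ℕ) :
    cnt (fun i => P i ∧ cnt P 0 i < s) 0 t = min s (cnt P 0 t) := by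
  induction t with
  | zero => simp [cnt_self]
  | succ t ih =>
    by_cases h : P t
    · rw [cnt_succ_of (P := P) (Nat.zero_le t) h]
      by_cases h1 : cnt P 0 t < s
      · rw [cnt_succ_of (Nat.zero_le t) ⟨h, h1⟩, ih]; omega
      · rw [cnt_succ_of_not (Nat.zero_le t) (fun h2 => h1 h2.2), ih]; omega
    · rw [cnt_succ_of_not (P := P) (Nat.zero_le t) h,
        cnt_succ_of_not (Nat.zero_le t) (fun h2 => h h2.1), ih]

theorem card_filter_fin {n : ℕ} (P : Fin n → Prop) [DecidablePred P] :
    (Finset.univ.filter P).card = cnt (fun i => ∃ h : i < n, P ⟨i, h⟩) 0 n := by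
  classical
  unfold cnt
  refine Finset.card_bij (fun i _ => i.1) (fun i hi => ?_) (fun i _ j _ h => Fin.ext h) ?_
  · simpa using (Finset.mem_filter.1 hi).2
  · intro i hi
    simp only [Finset.mem_filter] at hi
    obtain ⟨-, h, h'⟩ := hi
    exact ⟨⟨i, h⟩, by simpa using h', rfl⟩

end cnt

/-! ### The marked coordinates -/

section marking

variable {n : ℕ} (x : Fin n → Bool) (M : Finset (Fin n))

/-- The bit number `i` is 1. -/
def One (i : ℕ) : Prop := ∃ h : i < n, x ⟨i, h⟩ = true

/-- The bit number `i` is 0. -/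
def Zero (i : ℕ) : Prop := ∃ h : i < n, x ⟨i, h⟩ = false

/-- The coordinate `i` belongs to `M`. -/
def Mem (i : ℕ) : Prop := ∃ h : i < n, (⟨i, h⟩ : Fin n) ∈ M

/-- The coordinate `i` does not belong to `M`. -/
def Free (i : ℕ) : Prop := ∃ h : i < n, (⟨i, h⟩ : Fin n) ∉ M

theorem one_or_zero {i : ℕ} (h : i < n) : One x i ∨ Zero x i := by
  cases hx : x ⟨i, h⟩
  · exact Or.inr ⟨h, hx⟩
  · exact Or.inl ⟨h, hx⟩

theorem mem_or_free {i : ℕ} (h : i < n) : Mem M i ∨ Free M i := by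
  by_cases hx : (⟨i, h⟩ : Fin n) ∈ M
  · exact Or.inl ⟨h, hx⟩
  · exact Or.inr ⟨h, hx⟩

variable {x M} in
theorem One.not_zero {i : ℕ} (h : One x i) : ¬ Zero x i := by
  rintro ⟨h1, h2⟩; obtain ⟨_, h3⟩ := h; rw [h2] at h3; cases h3

variable {x M} in
theorem Mem.not_free {i : ℕ} (h : Mem M i) : ¬ Free M i := by
  rintro ⟨h1, h2⟩; obtain ⟨_, h3⟩ := h; exact h2 h3

/-- `M` is a union of nested pairs consisting of a 1 and a later 0, and no coordinate outside `M`
lies inside a pair or can be paired with another such coordinate. -/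
structure IsSplit : Prop where
  le : ∀ t, cnt (fun i => Mem M i ∧ Zero x i) 0 t ≤ cnt (fun i => Mem M i ∧ One x i) 0 t
  eq : ∀ t ≤ n, ¬ Mem M t →
    cnt (fun i => Mem M i ∧ Zero x i) 0 t = cnt (fun i => Mem M i ∧ One x i) 0 t
  sorted : ∀ i j, i < j → Free M i → Free M j → One x i → ¬ Zero x j

variable {x M}

/-- Marking a pair i < j adds a one before every t > i and a zero before every t > j. So marked
zeros never outnumber marked ones in a prefix, and the difference changes only for i < t ≤ j, where
t is marked afterwards. That the run has stopped gives `sorted`. -/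
theorem IsMarking.isSplit (h : IsMarking x M) : IsSplit x M := by
  have key : ∀ M, Relation.ReflTransGen (MarkStep x) ∅ M →
      (∀ t, cnt (fun i => Mem M i ∧ Zero x i) 0 t ≤ cnt (fun i => Mem M i ∧ One x i) 0 t) ∧
      ∀ t ≤ n, ¬ Mem M t →
        cnt (fun i => Mem M i ∧ Zero x i) 0 t = cnt (fun i => Mem M i ∧ One x i) 0 t := by
    intro M hM
    induction hM with
    | refl =>
      have h0 : ∀ (Q : ℕ → Prop) t, cnt (fun i => Mem (∅ : Finset (Fin n)) i ∧ Q i) 0 t = 0 :=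
        fun Q t => cnt_false fun i _ _ hi => by simp [Mem] at hi
      simp [h0]
    | tail _ hstep ih =>
      obtain ⟨i, j, hij, hi, hj, hbetween, hxi, hxj, rfl⟩ := hstep
      rename_i M M'
      have h1 := cnt_insert (P := fun l => Mem M l ∧ One x l)
        (Q := fun l => Mem (insert i (insert j M)) l ∧ One x l) (c := i) (fun l => ?_) ?_
      have h2 := cnt_insert (P := fun l => Mem M l ∧ Zero x l)
        (Q := fun l => Mem (insert i (insert j M)) l ∧ Zero x l) (c := j) (fun l => ?_) ?_
      · refine ⟨fun t => ?_, fun t ht hmem => ?_⟩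
        · rw [h1, h2]
          have := ih.1 t
          have : i.1 < j.1 := hij
          split_ifs <;> omega
        · rw [h1, h2, ih.2 t ht]
          · have : i.1 < j.1 := hij
            have h3 : t ≠ i.1 := by rintro rfl; exact hmem ⟨i.2, by simp⟩
            have h4 : t ≠ j.1 := by rintro rfl; exact hmem ⟨j.2, by simp⟩
            have h5 : ¬ (i.1 < t ∧ t < j.1) := fun h5 =>
              hmem ⟨h5.2.trans j.2, by simp [hbetween ⟨t, h5.2.trans j.2⟩ h5.1 h5.2]⟩
            split_ifs <;> omega
          · rintro ⟨h3, h4⟩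
            exact hmem ⟨h3, by simp [h4]⟩
      · constructor
        · rintro ⟨⟨h1, h2⟩, h3, h4⟩
          simp only [Finset.mem_insert] at h2
          rcases h2 with h2 | h2 | h2
          · rw [h2, hxi] at h4; cases h4
          · exact Or.inr (congrArg Fin.val h2)
          · exact Or.inl ⟨⟨h1, h2⟩, h3, h4⟩
        · rintro (⟨⟨h1, h2⟩, h3⟩ | rfl)
          · exact ⟨⟨h1, by simp [h2]⟩, h3⟩
          · exact ⟨⟨j.2, by simp⟩, j.2, hxj⟩
      · rintro ⟨⟨_, h⟩, -⟩; exact hj h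
      · constructor
        · rintro ⟨⟨h1, h2⟩, h3, h4⟩
          simp only [Finset.mem_insert] at h2
          rcases h2 with h2 | h2 | h2
          · exact Or.inr (congrArg Fin.val h2)
          · rw [h2, hxj] at h4; cases h4
          · exact Or.inl ⟨⟨h1, h2⟩, h3, h4⟩
        · rintro (⟨⟨h1, h2⟩, h3⟩ | rfl)
          · exact ⟨⟨h1, by simp [h2]⟩, h3⟩
          · exact ⟨⟨i.2, by simp⟩, i.2, hxi⟩
      · rintro ⟨⟨_, h⟩, -⟩; exact hi h
  refine ⟨(key M h.1).1, (key M h.1).2, ?_⟩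
  -- Induction on a bound for the distance: an unmarked bit strictly between an unmarked 1 and a
  -- later unmarked 0 would form a closer forbidden pair with one of them.
  suffices hs : ∀ d i j, j ≤ i + d → i < j → Free M i → Free M j → One x i → ¬ Zero x j from
    fun i j => hs j i j (Nat.le_add_left j i)
  intro d
  induction d with
  | zero => intro i j h1 h2; omega
  | succ d ih =>
    intro i j hd hij hi hj hxi hxj
    obtain ⟨hi1, hi2⟩ := hi
    obtain ⟨hj1, hj2⟩ := hj
    refine h.2 _ ⟨⟨i, hi1⟩, ⟨j, hj1⟩, hij, hi2, hj2, fun k hik hkj => ?_, hxi.2, hxj.2, rfl⟩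
    by_contra hk
    have hik : i < k.1 := hik
    have hkj : k.1 < j := hkj
    rcases one_or_zero x k.2 with hxk | hxk
    · exact ih k j (by omega) hkj ⟨k.2, hk⟩ ⟨hj1, hj2⟩ hxk hxj
    · exact ih i k (by omega) hik ⟨hi1, hi2⟩ ⟨k.2, hk⟩ hxi hxk

/-! ### Unmarked bits characterized by counts on intervals -/

namespace IsSplit

variable (h : IsSplit x M)
include h

/-- The witness is the left end of the run of marked coordinates just before `j`. It is 0 or follows
an unmarked coordinate, and the marked bits are balanced there. -/
theorem exists_left (j : ℕ) (hj : j ≤ n) : ∃ i ≤ j, (∀ l, i ≤ l → l < j → Mem M l) ∧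
    cnt (fun i => Mem M i ∧ Zero x i) 0 i = cnt (fun i => Mem M i ∧ One x i) 0 i := by
  induction j with
  | zero => exact ⟨0, le_rfl, fun l _ h => absurd h (by omega), by simp [cnt_self]⟩
  | succ j ih =>
    by_cases hm : Mem M j
    · obtain ⟨i, h1, h2, h3⟩ := ih (by omega)
      refine ⟨i, by omega, fun l h4 h5 => ?_, h3⟩
      rcases Nat.lt_succ_iff_lt_or_eq.1 h5 with h6 | rfl
      exacts [h2 l h4 h6, hm]
    · refine ⟨j + 1, le_rfl, fun l h1 h2 => absurd h1 (by omega), ?_⟩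
      rw [cnt_succ_of_not (Nat.zero_le j) (fun h => hm h.1),
        cnt_succ_of_not (Nat.zero_le j) (fun h => hm h.1), h.eq j (by omega) hm]

theorem exists_right (d i : ℕ) (hi : i + d = n) : ∃ j, i ≤ j ∧ j ≤ n ∧
    (∀ l, i ≤ l → l < j → Mem M l) ∧
    cnt (fun i => Mem M i ∧ Zero x i) 0 j = cnt (fun i => Mem M i ∧ One x i) 0 j := by
  induction d generalizing i with
  | zero =>
    exact ⟨i, le_rfl, by omega, fun l h1 h2 => absurd h1 (by omega),
      h.eq i (by omega) fun h => by obtain ⟨h, -⟩ := h; omega⟩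
  | succ d ih =>
    by_cases hm : Mem M i
    · obtain ⟨j, h1, h2, h3, h4⟩ := ih (i + 1) (by omega)
      refine ⟨j, by omega, h2, fun l h5 h6 => ?_, h4⟩
      rcases Nat.eq_or_lt_of_le h5 with rfl | h7
      exacts [hm, h3 l h7 h6]
    · exact ⟨i, le_rfl, by omega, fun l h1 h2 => absurd h1 (by omega), h.eq i (by omega) hm⟩

/-- Before an unmarked zero `j` all ones are marked. The marked bits balance at `j` and have no
excess of zeros before `i`, so ones do not outnumber zeros between `i` and `j`, and `j` adds one
more zero. Conversely, if `j` were marked, the interval from the left end of its marked run to `j`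
would be wholly marked and start in balance, hence contain at least as many ones as zeros. -/
theorem free_zero_iff (j : ℕ) : Free M j ∧ Zero x j ↔
    j < n ∧ ∀ i ≤ j, cnt (One x) i (j + 1) < cnt (Zero x) i (j + 1) := by
  constructor
  · rintro ⟨hj, hx⟩
    refine ⟨hj.1, fun i hi => ?_⟩
    rw [cnt_succ_of hi hx, cnt_succ_of_not hi (fun h => h.not_zero hx)]
    have h1 : cnt (One x) i j ≤ cnt (fun i => Mem M i ∧ One x i) i j :=
      cnt_mono fun l _ h2 h3 => ⟨(mem_or_free M (h2.trans hj.1)).resolve_right fun h4 =>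
        h.sorted l j h2 h4 hj h3 hx, h3⟩
    have h2 : cnt (fun i => Mem M i ∧ Zero x i) i j ≤ cnt (Zero x) i j :=
      cnt_mono fun l _ _ h3 => h3.2
    have h3 := cnt_add (P := fun i => Mem M i ∧ One x i) (Nat.zero_le i) hi
    have h4 := cnt_add (P := fun i => Mem M i ∧ Zero x i) (Nat.zero_le i) hi
    have h5 := h.eq j hj.1.le fun h => h.not_free hj
    have h6 := h.le i
    omega
  · rintro ⟨hj, hlt⟩
    have hx : Zero x j := by
      refine (one_or_zero x hj).resolve_left fun h1 => ?_
      have := hlt j le_rfl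
      rw [cnt_succ_of_not le_rfl h1.not_zero, cnt_self] at this
      omega
    refine ⟨(mem_or_free M hj).resolve_left fun hm => ?_, hx⟩
    obtain ⟨i, hi, h1, h2⟩ := h.exists_left j hj.le
    have h3 : ∀ l, i ≤ l → l < j + 1 → Mem M l := fun l h4 h5 => by
      rcases Nat.lt_succ_iff_lt_or_eq.1 h5 with h6 | rfl
      exacts [h1 l h4 h6, hm]
    have h4 : cnt (fun i => Mem M i ∧ One x i) i (j + 1) = cnt (One x) i (j + 1) :=
      cnt_congr fun l h5 h6 => and_iff_right (h3 l h5 h6)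
    have h5 : cnt (fun i => Mem M i ∧ Zero x i) i (j + 1) = cnt (Zero x) i (j + 1) :=
      cnt_congr fun l h5 h6 => and_iff_right (h3 l h5 h6)
    have h6 := cnt_add (P := fun i => Mem M i ∧ One x i) (Nat.zero_le i) (hi.trans (Nat.le_succ j))
    have h7 := cnt_add (P := fun i => Mem M i ∧ Zero x i) (Nat.zero_le i) (hi.trans (Nat.le_succ j))
    have h8 := h.le (j + 1)
    have h9 := hlt i hi
    simp only [Nat.succ_eq_add_one] at h6 h7
    omega

/-- The mirror image: after an unmarked one all zeros are marked, and for a marked coordinate the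
violating interval extends to the right end of its marked run. -/
theorem free_one_iff (i : ℕ) : Free M i ∧ One x i ↔
    i < n ∧ ∀ j, i ≤ j → j < n → cnt (Zero x) i (j + 1) < cnt (One x) i (j + 1) := by
  constructor
  · rintro ⟨hi, hx⟩
    refine ⟨hi.1, fun j hij hj => ?_⟩
    have hm : ¬ Mem M i := fun h => h.not_free hi
    rw [← cnt_add (Nat.le_succ i) (show i + 1 ≤ j + 1 by omega),
      ← cnt_add (P := One x) (Nat.le_succ i) (show i + 1 ≤ j + 1 by omega), Nat.succ_eq_add_one,
      cnt_succ_of_not le_rfl hx.not_zero, cnt_succ_of le_rfl hx, cnt_self, cnt_self]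
    have h1 : cnt (Zero x) (i + 1) (j + 1) ≤ cnt (fun i => Mem M i ∧ Zero x i) (i + 1) (j + 1) :=
      cnt_mono fun l h1 h2 h3 => ⟨(mem_or_free M (by omega)).resolve_right fun h4 =>
        h.sorted i l h1 hi h4 hx h3, h3⟩
    have h2 : cnt (fun i => Mem M i ∧ One x i) (i + 1) (j + 1) ≤ cnt (One x) (i + 1) (j + 1) :=
      cnt_mono fun l _ _ h3 => h3.2
    have h3 := cnt_add (P := fun i => Mem M i ∧ One x i) (Nat.zero_le (i + 1))
      (show i + 1 ≤ j + 1 by omega)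
    have h4 := cnt_add (P := fun i => Mem M i ∧ Zero x i) (Nat.zero_le (i + 1))
      (show i + 1 ≤ j + 1 by omega)
    rw [cnt_succ_of_not (Nat.zero_le i) (fun h => hm h.1)] at h3 h4
    have h5 := h.eq i hi.1.le hm
    have h6 := h.le (j + 1)
    omega
  · rintro ⟨hi, hlt⟩
    have hx : One x i := by
      refine (one_or_zero x hi).resolve_right fun h1 => ?_
      have := hlt i le_rfl hi
      rw [cnt_succ_of_not (P := One x) le_rfl fun h => h.not_zero h1, cnt_self] at this
      omega
    refine ⟨(mem_or_free M hi).resolve_left fun hm => ?_, hx⟩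
    obtain ⟨j, hij, hj, h1, h2⟩ := h.exists_right (n - (i + 1)) (i + 1) (by omega)
    have h3 : ∀ l, i ≤ l → l < j → Mem M l := fun l h4 h5 => by
      rcases Nat.eq_or_lt_of_le h4 with rfl | h6
      exacts [hm, h1 l h6 h5]
    have h4 : cnt (fun i => Mem M i ∧ One x i) i j = cnt (One x) i j :=
      cnt_congr fun l h5 h6 => and_iff_right (h3 l h5 h6)
    have h5 : cnt (fun i => Mem M i ∧ Zero x i) i j = cnt (Zero x) i j :=
      cnt_congr fun l h5 h6 => and_iff_right (h3 l h5 h6)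
    have h6 := cnt_add (P := fun i => Mem M i ∧ One x i) (Nat.zero_le i) (show i ≤ j by omega)
    have h7 := cnt_add (P := fun i => Mem M i ∧ Zero x i) (Nat.zero_le i) (show i ≤ j by omega)
    have h8 := h.le i
    -- The run ends before `j`, so the last coordinate of the violating interval is `j - 1`.
    have h9 := hlt (j - 1) (by omega) (by omega)
    rw [show j - 1 + 1 = j by omega] at h9
    omega

/-- The two characterizations of the unmarked bits mention only `x`. So the outcome of the marking
is unique, and any set with the split property is the marked set. -/
theorem eq_of_isSplit {M' : Finset (Fin n)} (h' : IsSplit x M') : M = M' := by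
  have key : ∀ i, Free M i ↔ Free M' i := by
    intro i
    by_cases hi : i < n
    · rcases one_or_zero x hi with hx | hx
      · exact ⟨fun hf => ((h'.free_one_iff i).2 ((h.free_one_iff i).1 ⟨hf, hx⟩)).1,
          fun hf => ((h.free_one_iff i).2 ((h'.free_one_iff i).1 ⟨hf, hx⟩)).1⟩
      · exact ⟨fun hf => ((h'.free_zero_iff i).2 ((h.free_zero_iff i).1 ⟨hf, hx⟩)).1,
          fun hf => ((h.free_zero_iff i).2 ((h'.free_zero_iff i).1 ⟨hf, hx⟩)).1⟩
    · exact ⟨fun hf => absurd hf.1 hi, fun hf => absurd hf.1 hi⟩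
  ext i
  have := key i
  by_contra hc
  by_cases h1 : i ∈ M
  · have h2 : i ∉ M' := fun h2 => hc ⟨fun _ => h2, fun _ => h1⟩
    exact (this.2 ⟨i.2, h2⟩).2 h1
  · have h2 : i ∈ M' := by_contra fun h2 => hc ⟨fun h => absurd h h1, fun h => absurd h h2⟩
    exact (this.1 ⟨i.2, h1⟩).2 h2

end IsSplit

theorem isSplit_marked (x : Fin n → Bool) : IsSplit x (marked x) := (marked_spec x).isSplit

/-- `i` is an unmarked coordinate with bit 0. -/
def FreeZero (x : Fin n → Bool) (i : ℕ) : Prop := Free (marked x) i ∧ Zero x i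

/-- `i` is an unmarked coordinate with bit 1. -/
def FreeOne (x : Fin n → Bool) (i : ℕ) : Prop := Free (marked x) i ∧ One x i

theorem FreeZero.not_freeOne {i : ℕ} (h : FreeZero x i) : ¬ FreeOne x i :=
  fun h' => h'.2.not_zero h.2

/-- The number of unmarked zeros. -/
noncomputable def freeZeros (x : Fin n → Bool) : ℕ := cnt (FreeZero x) 0 n

theorem cnt_free (x : Fin n → Bool) {a b : ℕ} (hb : b ≤ n) :
    cnt (Free (marked x)) a b = cnt (FreeZero x) a b + cnt (FreeOne x) a b := by
  refine cnt_or (fun i _ h => ?_) fun i _ _ h => h.not_freeOne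
  have := one_or_zero x (h.trans_le hb)
  unfold FreeZero FreeOne
  tauto

theorem freeOne_before {i : ℕ} (h : FreeZero x i) : cnt (FreeOne x) 0 i = 0 :=
  cnt_false fun l _ hl hf => (isSplit_marked x).sorted l i hl hf.1 h.1 hf.2 h.2

theorem freeZero_before {i : ℕ} (h : FreeOne x i) : cnt (FreeZero x) 0 i = freeZeros x := by
  have h1 := cnt_add (P := FreeZero x) (Nat.zero_le i) h.1.1.le
  rw [cnt_false (a := i) fun l hl _ hf => ?_] at h1
  · exact h1
  · rcases Nat.eq_or_lt_of_le hl with rfl | hl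
    · exact hf.not_freeOne h
    · exact (isSplit_marked x).sorted i l hl h.1 hf.1 h.2 hf.2

theorem freeZero_split {i : ℕ} (h : FreeZero x i) :
    freeZeros x = cnt (FreeZero x) 0 i + 1 + cnt (FreeZero x) (i + 1) n := by
  rw [← cnt_succ_of (Nat.zero_le i) h]
  exact (cnt_add (Nat.zero_le _) h.1.1).symm

/-- The number of ones and the length in terms of the numbers of unmarked zeros and ones. -/
theorem exists_counts (x : Fin n → Bool) : ∃ k, weight x = k + cnt (FreeOne x) 0 n ∧
    n = 2 * k + freeZeros x + cnt (FreeOne x) 0 n := by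
  refine ⟨cnt (fun i => Mem (marked x) i ∧ One x i) 0 n, ?_, ?_⟩
  · unfold weight
    rw [card_filter_fin]
    refine cnt_or (fun i _ hi => ?_) fun i _ _ h h' => h.1.not_free h'.1
    have := mem_or_free (marked x) hi
    change One x i ↔ _
    unfold FreeOne
    tauto
  · have h1 : cnt (fun _ => True) 0 n = n := by rw [cnt_true fun _ _ _ => trivial]; simp
    have h2 : cnt (fun _ => True) 0 n = cnt (Mem (marked x)) 0 n + cnt (Free (marked x)) 0 n :=
      cnt_or (fun i _ hi => ⟨fun _ => mem_or_free _ hi, fun _ => trivial⟩) fun i _ _ h => h.not_free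
    have h3 : cnt (Mem (marked x)) 0 n = cnt (fun i => Mem (marked x) i ∧ Zero x i) 0 n +
        cnt (fun i => Mem (marked x) i ∧ One x i) 0 n := by
      refine cnt_or (fun i _ hi => ?_) fun i _ _ h h' => h'.2.not_zero h.2
      have := one_or_zero x hi
      tauto
    have h4 := (isSplit_marked x).eq n le_rfl fun h => absurd h.1 (lt_irrefl n)
    have h5 := cnt_free x (a := 0) le_rfl
    change n = 2 * _ + cnt (FreeZero x) 0 n + _
    omega

/-! ### Refilling the unmarked coordinates -/

open Classical in
/-- The string that agrees with `x` on the marked coordinates, with `s` zeros followed by ones on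
the others. -/
noncomputable def fill (x : Fin n → Bool) (s : ℕ) : Fin n → Bool := fun i =>
  if i ∈ marked x then x i else decide (s ≤ cnt (Free (marked x)) 0 i)

theorem fill_of_mem {i : Fin n} (h : i ∈ marked x) (s : ℕ) : fill x s i = x i := if_pos h

theorem fill_of_notMem {i : Fin n} (h : i ∉ marked x) (s : ℕ) :
    fill x s i = decide (s ≤ cnt (Free (marked x)) 0 i) := if_neg h

/-- The marked bits are untouched and the new unmarked bits are again zeros followed by ones. Thus
the old marked set is a split of the new string, and uniqueness applies. -/
theorem marked_fill (x : Fin n → Bool) (s : ℕ) : marked (fill x s) = marked x := by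
  refine (isSplit_marked _).eq_of_isSplit ?_
  have h0 : (fun i => Mem (marked x) i ∧ Zero (fill x s) i) =
      fun i => Mem (marked x) i ∧ Zero x i := by
    funext i
    refine propext (and_congr_right fun h => ?_)
    unfold Zero
    exact exists_congr fun hi => by rw [fill_of_mem h.2]
  have h1 : (fun i => Mem (marked x) i ∧ One (fill x s) i) =
      fun i => Mem (marked x) i ∧ One x i := by
    funext i
    refine propext (and_congr_right fun h => ?_)
    unfold One
    exact exists_congr fun hi => by rw [fill_of_mem h.2]
  refine ⟨?_, ?_, fun i j hij hi hj h2 h3 => ?_⟩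
  · rw [h0, h1]; exact (isSplit_marked x).le
  · rw [h0, h1]; exact (isSplit_marked x).eq
  · have h4 := h2.2
    have h5 := h3.2
    rw [fill_of_notMem hi.2, decide_eq_true_eq] at h4
    rw [fill_of_notMem hj.2, decide_eq_false_iff_not] at h5
    have := cnt_add (P := Free (marked x)) (Nat.zero_le i) hij.le
    simp only at h4 h5
    omega

theorem fill_fill (x : Fin n → Bool) (s t : ℕ) : fill (fill x s) t = fill x t := by
  funext i
  by_cases h : i ∈ marked x
  · rw [fill_of_mem (by rwa [marked_fill]), fill_of_mem h, fill_of_mem h]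
  · rw [fill_of_notMem (by rwa [marked_fill]), fill_of_notMem h, marked_fill]

theorem freeZeros_fill {s : ℕ} (h : s ≤ cnt (Free (marked x)) 0 n) : freeZeros (fill x s) = s := by
  have h1 : freeZeros (fill x s) =
      cnt (fun i => Free (marked x) i ∧ cnt (Free (marked x)) 0 i < s) 0 n := by
    refine cnt_congr fun i _ hi => ?_
    unfold FreeZero
    rw [marked_fill]
    refine and_congr_right fun hf => ?_
    constructor
    · rintro ⟨_, h2⟩
      rw [fill_of_notMem hf.2, decide_eq_false_iff_not] at h2
      simpa using h2
    · intro h2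
      refine ⟨hi, ?_⟩
      rw [fill_of_notMem hf.2, decide_eq_false_iff_not]
      simpa using h2
  rw [h1, cnt_rank_lt, min_eq_left h]

theorem fill_freeZeros (x : Fin n → Bool) : fill x (freeZeros x) = x := by
  funext i
  by_cases h : i ∈ marked x
  · exact fill_of_mem h _
  · have hf : Free (marked x) i := ⟨i.2, h⟩
    rw [fill_of_notMem h, cnt_free x i.2.le]
    rcases one_or_zero x i.2 with hx | hx
    · rw [freeZero_before ⟨hf, hx⟩, decide_eq_true (Nat.le_add_right _ _)]
      exact hx.2.symm
    · rw [freeOne_before ⟨hf, hx⟩, freeZero_split ⟨hf, hx⟩, decide_eq_false (by omega)]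
      exact hx.2.symm

end marking

/-! ### The mapping and its inverse -/

section psi

variable {n : ℕ}

/-- Let f be the number of unmarked zeros and t the top index of the chain. Then t - |x| = f, so the
parity test asks whether f is even, and both branches choose the index t - ⌊f/2⌋, whose element has
⌊f/2⌋ zeros on the blanks. -/
theorem psi_eq (x : Fin n → Bool) :
    psi n x = Fin.snoc (fill x (freeZeros x / 2)) (decide (freeZeros x % 2 = 0)) := by
  have hblank : ∀ l : Fin n, code x l = none ↔ l ∉ marked x := by
    intro l; unfold code; split <;> simp_all
  have hb : blanks (code x) = freeZeros x + cnt (FreeOne x) 0 n := by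
    unfold blanks freeZeros
    rw [card_filter_fin, ← cnt_free x le_rfl]
    exact cnt_congr fun i _ hi => exists_congr fun h => hblank _
  have hr : ∀ i : Fin n, (Finset.univ.filter fun l => l < i ∧ code x l = none).card =
      cnt (Free (marked x)) 0 i := by
    intro i
    rw [card_filter_fin, ← cnt_add (Nat.zero_le i.1) i.2.le,
      cnt_false (a := i.1) fun l hl _ h => absurd h.2.1 (not_lt.2 hl), add_zero]
    refine cnt_congr fun l _ hl => exists_congr fun h => ?_
    rw [hblank]
    exact and_iff_right hl
  have hc : ∀ r, blanks (code x) - (r - bottom (code x)) = freeZeros x / 2 →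
      chain (code x) r = fill x (freeZeros x / 2) := by
    intro r h
    funext i
    by_cases hi : i ∈ marked x
    · rw [fill_of_mem hi, chain, code, if_pos hi]
    · rw [fill_of_notMem hi, chain, (hblank i).2 hi]
      simp only [h, hr]
  obtain ⟨k, hw, hn⟩ := exists_counts x
  have hbot : bottom (code x) = k := by
    unfold bottom; rw [hb]; omega
  simp only [psi]
  by_cases he : freeZeros x % 2 = 0
  · rw [if_pos (by rw [hbot]; omega), hc, decide_eq_true he]
    rw [hbot, hb]; omega
  · rw [if_neg (by rw [hbot]; omega), hc, decide_eq_false he]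
    rw [hbot, hb]; omega

/-- Lowering the number of unmarked zeros from f to ⌊f/2⌋ only turns zeros into ones. An unmarked
zero with a predecessors and b successors among the f = a + 1 + b unmarked zeros is turned iff ⌊f/2⌋
≤ a, that is b ≤ a. -/
theorem one_psi_iff (x : Fin n → Bool) {i : ℕ} (hi : i < n) :
    psi n x ⟨i, hi.trans (Nat.lt_succ_self n)⟩ = true ↔ One x i ∨
      FreeZero x i ∧ cnt (FreeZero x) (i + 1) n ≤ cnt (FreeZero x) 0 i := by
  rw [psi_eq, show (⟨i, hi.trans (Nat.lt_succ_self n)⟩ : Fin (n + 1)) =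
      Fin.castSucc ⟨i, hi⟩ from rfl,
    Fin.snoc_castSucc]
  by_cases hm : (⟨i, hi⟩ : Fin n) ∈ marked x
  · rw [fill_of_mem hm]
    constructor
    · exact fun h => Or.inl ⟨hi, h⟩
    · rintro (h | h)
      exacts [h.2, absurd hm h.1.1.2]
  · have hf : Free (marked x) i := ⟨hi, hm⟩
    rw [fill_of_notMem hm, decide_eq_true_eq, cnt_free x hi.le]
    rcases one_or_zero x hi with hx | hx
    · rw [freeZero_before ⟨hf, hx⟩]
      exact ⟨fun _ => Or.inl hx, fun _ => by omega⟩
    · rw [freeOne_before ⟨hf, hx⟩, freeZero_split ⟨hf, hx⟩]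
      constructor
      · exact fun h => Or.inr ⟨⟨hf, hx⟩, by omega⟩
      · rintro (h | h)
        · exact absurd hx h.not_zero
        · omega

/-- The number of unmarked zeros is odd iff one of them has equally many on either side. -/
theorem psi_last_iff (x : Fin n → Bool) : psi n x (Fin.last n) = true ↔
    ¬ ∃ i < n, FreeZero x i ∧ cnt (FreeZero x) (i + 1) n ≤ cnt (FreeZero x) 0 i ∧
      cnt (FreeZero x) 0 i ≤ cnt (FreeZero x) (i + 1) n := by
  rw [psi_eq, Fin.snoc_last, decide_eq_true_eq]
  constructor
  · rintro h ⟨i, _, h1, h2, h3⟩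
    have := freeZero_split h1
    omega
  · intro h
    by_contra hc
    obtain ⟨i, hi, h1, h2⟩ := exists_cnt_eq (P := FreeZero x) (s := freeZeros x / 2) (t := n)
      (by change _ < freeZeros x; omega)
    have := freeZero_split h1
    exact h ⟨i, hi, h1, by omega, by omega⟩

/-- An explicit formula for the inverse mapping. -/
noncomputable def unpsi (w : Fin (n + 1) → Bool) : Fin n → Bool :=
  fill (fun i => w i.castSucc)
    (2 * freeZeros (fun i => w i.castSucc) + if w (Fin.last n) = true then 0 else 1)

/-- With z unmarked zeros and e = 1 for last bit 0 (else e = 0), the first 2z + e unmarked positions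
receive 0. The first z of these hold zeros already, so the bits lowered are the first z + e unmarked
ones. -/
theorem one_unpsi_iff (w : Fin (n + 1) → Bool) (i : Fin n) :
    unpsi w i = true ↔ w i.castSucc = true ∧ ¬ (FreeOne (fun i => w i.castSucc) i ∧
      cnt (FreeOne fun i => w i.castSucc) 0 i <
        freeZeros (fun i => w i.castSucc) + if w (Fin.last n) = true then 0 else 1) := by
  unfold unpsi
  generalize (if w (Fin.last n) = true then 0 else 1) = e
  generalize hc : (fun i => w (Fin.castSucc i)) = c
  change _ ↔ (fun i => w (Fin.castSucc i)) i = true ∧ _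
  rw [hc]
  by_cases hm : i ∈ marked c
  · rw [fill_of_mem hm]
    exact ⟨fun h => ⟨h, fun h' => h'.1.1.2 hm⟩, fun h => h.1⟩
  · have hf : Free (marked c) i := ⟨i.2, hm⟩
    rw [fill_of_notMem hm, decide_eq_true_eq, cnt_free c i.2.le]
    rcases one_or_zero c i.2 with hx | hx
    · rw [freeZero_before ⟨hf, hx⟩]
      constructor
      · exact fun h => ⟨hx.2, fun h' => by omega⟩
      · intro h
        by_contra h'
        exact h.2 ⟨⟨hf, hx⟩, by omega⟩
    · rw [freeOne_before ⟨hf, hx⟩, freeZero_split ⟨hf, hx⟩]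
      constructor
      · intro h; omega
      · intro h
        exact absurd hx (One.not_zero ⟨i.2, h.1⟩)

theorem castSucc_psi (x : Fin n → Bool) :
    (fun i => psi n x i.castSucc) = fill x (freeZeros x / 2) := by
  funext i; rw [psi_eq, Fin.snoc_castSucc]

theorem freeZeros_le (x : Fin n → Bool) : freeZeros x ≤ cnt (Free (marked x)) 0 n := by
  rw [cnt_free x le_rfl]; exact Nat.le_add_right _ _

theorem unpsi_psi (x : Fin n → Bool) : unpsi (psi n x) = x := by
  unfold unpsi
  rw [castSucc_psi, fill_fill, freeZeros_fill ((Nat.div_le_self _ _).trans (freeZeros_le x)),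
    psi_eq,
    Fin.snoc_last]
  conv_rhs => rw [← fill_freeZeros x]
  congr 1
  by_cases h : freeZeros x % 2 = 0 <;> simp [h] <;> omega

/-- If the first n bits have k marked pairs, z unmarked zeros and o unmarked ones, then n = 2k + z +
o and the weight is k + o plus the last bit. -/
theorem mem_ball_iff (w : Fin (n + 1) → Bool) : w ∈ ball n ↔
    freeZeros (fun i => w i.castSucc) < cnt (FreeOne fun i => w i.castSucc) 0 n +
      2 * if w (Fin.last n) = true then 1 else 0 := by
  obtain ⟨k, hw, hn⟩ := exists_counts fun i => w i.castSucc
  have h : weight w = weight (fun i => w i.castSucc) + if w (Fin.last n) = true then 1 else 0 := by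
    unfold weight
    rw [card_filter_fin, card_filter_fin]
    have h1 : cnt (fun i => ∃ h : i < n + 1, w ⟨i, h⟩ = true) 0 n =
        cnt (fun i => ∃ h : i < n, w (Fin.castSucc ⟨i, h⟩) = true) 0 n :=
      cnt_congr fun i _ hi => ⟨fun h => ⟨hi, h.2⟩, fun h => ⟨hi.trans (Nat.lt_succ_self n), h.2⟩⟩
    by_cases hl : w (Fin.last n) = true
    · rw [cnt_succ_of (Nat.zero_le n) ⟨Nat.lt_succ_self n, hl⟩, h1, if_pos hl]
    · rw [cnt_succ_of_not (Nat.zero_le n) fun h => hl h.2, h1, if_neg hl, add_zero]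
  change n < 2 * weight w ↔ _
  rw [h]
  omega

theorem psi_mem_ball (x : Fin n → Bool) : psi n x ∈ ball n := by
  rw [mem_ball_iff, castSucc_psi,
    freeZeros_fill ((Nat.div_le_self _ _).trans (freeZeros_le x)), psi_eq, Fin.snoc_last]
  have h1 := cnt_free (fill x (freeZeros x / 2)) (a := 0) le_rfl
  have h2 := freeZeros_fill ((Nat.div_le_self (freeZeros x) 2).trans (freeZeros_le x))
  rw [marked_fill, cnt_free x le_rfl] at h1
  unfold freeZeros at *
  by_cases h : cnt (FreeZero x) 0 n % 2 = 0 <;> simp only [h, decide_true, decide_false, if_true,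
    Bool.false_eq_true, if_false] <;> omega

theorem psi_unpsi (hn : Even n) {w : Fin (n + 1) → Bool} (hw : w ∈ ball n) :
    psi n (unpsi w) = w := by
  rw [mem_ball_iff] at hw
  -- There must be room for the zeros of the preimage. If the last bit is 1, the ball only yields z
  -- ≤ o + 1, and z = o + 1 is excluded because z + o has the parity of n.
  have hle : 2 * freeZeros (fun i => w i.castSucc) + (if w (Fin.last n) = true then 0 else 1) ≤
      cnt (Free (marked fun i => w i.castSucc)) 0 n := by
    obtain ⟨k, -, h2⟩ := exists_counts fun i => w i.castSucc
    obtain ⟨l, hl⟩ := hn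
    rw [cnt_free _ le_rfl]
    change _ ≤ freeZeros _ + _
    split_ifs at hw ⊢ <;> omega
  rw [psi_eq, unpsi, freeZeros_fill hle, fill_fill]
  funext i
  refine Fin.lastCases ?_ (fun i => ?_) i
  · rw [Fin.snoc_last]
    cases w (Fin.last n) <;> simp
  · rw [Fin.snoc_castSucc, show (2 * freeZeros (fun i => w (Fin.castSucc i)) +
      if w (Fin.last n) = true then 0 else 1) / 2 = freeZeros fun i => w (Fin.castSucc i) by
        split_ifs <;> omega, fill_freeZeros]

theorem bijOn_psi (hn : Even n) : Set.BijOn (psi n) Set.univ (ball n) :=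
  Set.InvOn.bijOn (f' := unpsi) ⟨fun x _ => unpsi_psi x, fun _ hw => psi_unpsi hn hw⟩
    (fun x _ => psi_mem_ball x) fun _ _ => Set.mem_univ _

theorem psiInv_eq (hn : Even n) {w : Fin (n + 1) → Bool} (hw : w ∈ ball n) :
    psiInv n w = unpsi w := by
  have h : psi n (psiInv n w) = w := Function.invFun_eq ⟨_, psi_unpsi hn hw⟩
  rw [← unpsi_psi (psiInv n w), h]

end psi

end CubeBall

namespace ThresholdCircuit

open Turing

/-! ### A multistack machine that runs a finite automaton on a query in linear time -/

/-- A letter of the word that a finite automaton reads: one bit of the index `N`, three bits of the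
first name and up to three bits of the second argument of a question. -/
abbrev Column := Fin 7 → Option Bool

/-- The first column of the word for an index `n`, a name `a` and a second argument `b`, which is
read in blocks of three bits if `wide` holds and bit by bit otherwise. -/
def headColumn (wide : Bool) (n a b : List Bool) : Column :=
  ![n.head?, a.head?, a.tail.head?, a.tail.tail.head?, b.head?,
    if wide then b.tail.head? else none, if wide then b.tail.tail.head? else none]

/-- What is left of the second argument after one column. -/
def dropBlock (wide : Bool) (b : List Bool) : List Bool :=
  if wide then b.tail.tail.tail else b.tail

theorem length_dropBlock_le (wide : Bool) (b : List Bool) :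
    (dropBlock wide b).length ≤ b.length - 1 := by
  unfold dropBlock; split <;> simp; omega

/-- The word over the alphabet of columns that is formed by an index and two arguments. -/
def columns (wide : Bool) (n a b : List Bool) : List Column :=
  if n = [] ∧ a = [] ∧ b = [] then []
  else headColumn wide n a b :: columns wide n.tail a.tail.tail.tail (dropBlock wide b)
termination_by n.length + a.length + b.length
decreasing_by
  rename_i h
  have h1 := length_dropBlock_le wide b
  simp only [List.length_tail]
  by_contra hc
  refine h ⟨List.length_eq_zero_iff.1 ?_, List.length_eq_zero_iff.1 ?_,
    List.length_eq_zero_iff.1 ?_⟩ <;> omega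

theorem columns_nil (wide : Bool) : columns wide [] [] [] = [] := by
  rw [columns]; simp

theorem columns_cons (wide : Bool) {n a b : List Bool} (h : ¬ (n = [] ∧ a = [] ∧ b = [])) :
    columns wide n a b =
      headColumn wide n a b :: columns wide n.tail a.tail.tail.tail (dropBlock wide b) := by
  rw [columns, if_neg h]

theorem length_columns_le (wide : Bool) (n a b : List Bool) :
    (columns wide n a b).length ≤ n.length + a.length + b.length := by
  induction n, a, b using columns.induct wide with
  | case1 n a b h => obtain ⟨rfl, rfl, rfl⟩ := h; simp [columns_nil]
  | case2 n a b h ih =>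
    rw [columns_cons wide h]
    have h1 := length_dropBlock_le wide b
    simp only [List.length_tail, List.length_cons] at ih ⊢
    have : n.length ≠ 0 ∨ a.length ≠ 0 ∨ b.length ≠ 0 := by
      by_contra hc
      push Not at hc
      exact h ⟨List.length_eq_zero_iff.1 hc.1, List.length_eq_zero_iff.1 hc.2.1,
        List.length_eq_zero_iff.1 hc.2.2⟩
    omega

/-- This is the stopping test of the machine. The words are consumed from the front, so their first
entries already show whether they are exhausted. -/
theorem headColumn_eq_none_iff (wide : Bool) (n a b : List Bool) :
    headColumn wide n a b = (fun _ => none) ↔ n = [] ∧ a = [] ∧ b = [] := by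
  constructor
  · intro h
    have h0 := congrFun h 0
    have h1 := congrFun h 1
    have h4 := congrFun h 4
    simp only [headColumn] at h0 h1 h4
    exact ⟨by simpa using h0, by simpa using h1, by simpa using h4⟩
  · rintro ⟨rfl, rfl, rfl⟩
    funext i
    fin_cases i <;> simp [headColumn]

namespace QueryMachine

/-- The tapes: the input, two auxiliary tapes that receive the index and the name in reverse
order, and two tapes for these words in the right order. -/
inductive Stack
  | input | numberRev | nameRev | number | name
  deriving DecidableEq

instance : Fintype Stack :=
  ⟨{.input, .numberRev, .nameRev, .number, .name}, fun k => by cases k <;> simp⟩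

/-- The alphabets of the tapes. -/
abbrev Alphabet : Stack → Type
  | .input => Sym
  | _ => Bool

/-- The program labels. -/
inductive Phase
  | readNumber | readName | reverseNumber | reverseName | run
  deriving DecidableEq

instance : Fintype Phase :=
  ⟨{.readNumber, .readName, .reverseNumber, .reverseName, .run}, fun k => by cases k <;> simp⟩

/-- The registers: the symbol read last, the kind of the question, the current column and the
state of the automaton. -/
structure Registers (S : Type) where
  last : Option Sym
  kind : Option Sym
  col : Column
  state : S

noncomputable instance (S : Type) [Fintype S] : Fintype (Registers S) :=
  Fintype.ofInjective (fun r : Registers S => (r.last, r.kind, r.col, r.state)) fun r r' h => by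
    cases r; cases r'; simpa using h

/-- Writes one entry of the current column. -/
def Registers.set {S : Type} (r : Registers S) (k : Fin 7) (o : Option Bool) : Registers S :=
  { r with col := fun i => if i = k then o else r.col i }

theorem Registers.set_narrow {S : Type} (r : Registers S) (n a b c d : Option Bool) :
    ((((({ r with col := fun _
      => none } : Registers S).set 0 n).set 1 a).set 2 b).set 3 c).set 4 d =
      { r with col := ![n, a, b, c, d, none, none] } := by
  refine congrArg (Registers.mk r.last r.kind · r.state) (funext fun i => ?_)
  fin_cases i <;> rfl

theorem Registers.set_wide {S : Type} (r : Registers S) (n a b c d e f : Option Bool) :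
    (({ r with col := ![n, a, b, c, d, none, none] } : Registers S).set 5 e).set 6 f =
      { r with col := ![n, a, b, c, d, e, f] } := by
  refine congrArg (Registers.mk r.last r.kind · r.state) (funext fun i => ?_)
  fin_cases i <;> rfl

/-- The bit that a symbol stands for. -/
def symBit : Sym → Option Bool
  | .bit b => some b
  | _ => none

/-- The configuration of the tapes. -/
def tapes (i : List Sym) (nr ar n a : List Bool) : ∀ k, List (Alphabet k)
  | .input => i
  | .numberRev => nr
  | .nameRev => ar
  | .number => n
  | .name => a

section
variable (i i' : List Sym) (nr ar n a l : List Bool)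

@[simp] theorem tapes_input : tapes i nr ar n a .input = i := rfl
@[simp] theorem tapes_numberRev : tapes i nr ar n a .numberRev = nr := rfl
@[simp] theorem tapes_nameRev : tapes i nr ar n a .nameRev = ar := rfl
@[simp] theorem tapes_number : tapes i nr ar n a .number = n := rfl
@[simp] theorem tapes_name : tapes i nr ar n a .name = a := rfl

@[simp] theorem update_input :
    Function.update (tapes i nr ar n a) .input i' = tapes i' nr ar n a := by
  funext k; cases k <;> rfl
@[simp] theorem update_numberRev :
    Function.update (tapes i nr ar n a) .numberRev l = tapes i l ar n a := by
  funext k; cases k <;> rfl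
@[simp] theorem update_nameRev :
    Function.update (tapes i nr ar n a) .nameRev l = tapes i nr l n a := by
  funext k; cases k <;> rfl
@[simp] theorem update_number :
    Function.update (tapes i nr ar n a) .number l = tapes i nr ar l a := by
  funext k; cases k <;> rfl
@[simp] theorem update_name :
    Function.update (tapes i nr ar n a) .name l = tapes i nr ar n l := by
  funext k; cases k <;> rfl
end

variable {S : Type} (δ : S → Column → S) (s₀ : S) (acc : Option Sym → S → Bool)

/-- Whether the second argument is read in blocks of three bits. -/
def isWide (k : Option Sym) : Bool := k = some Sym.wire

/-- The initial contents of the registers. -/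
def initial : Registers S := ⟨none, none, fun _ => none, s₀⟩

open TM2.Stmt in
/-- The program. -/
def program : Phase → TM2.Stmt Alphabet Phase (Registers S)
  | .readNumber =>
    pop .input (fun r o => { r with last := o }) <|
    branch (fun r => ((r.last.bind symBit).isSome))
      (push .numberRev (fun r => ((r.last.bind symBit).getD false : Bool)) <|
        goto fun _ => .readNumber)
      (load (fun r => { r with kind := r.last }) <| goto fun _ => .readName)
  | .readName =>
    pop .input (fun r o => { r with last := o }) <|
    branch (fun r => ((r.last.bind symBit).isSome))
      (push .nameRev (fun r => ((r.last.bind symBit).getD false : Bool)) <|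
        goto fun _ => .readName)
      -- The separator, if there is one, has been popped. The second argument stays on the input
      -- tape, where it is already in reading order.
      (goto fun _ => .reverseNumber)
  | .reverseNumber =>
    pop .numberRev (fun r (o : Option Bool) => { r with last := o.map Sym.bit }) <|
    branch (fun r => ((r.last.bind symBit).isSome))
      (push .number (fun r => ((r.last.bind symBit).getD false : Bool)) <|
        goto fun _ => .reverseNumber)
      (goto fun _ => .reverseName)
  | .reverseName =>
    pop .nameRev (fun r (o : Option Bool) => { r with last := o.map Sym.bit }) <|
    branch (fun r => ((r.last.bind symBit).isSome))
      (push .name (fun r => ((r.last.bind symBit).getD false : Bool)) <|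
        goto fun _ => .reverseName)
      (goto fun _ => .run)
  | .run =>
    let next : TM2.Stmt Alphabet Phase (Registers S) :=
      -- A blank column means that all words are used up. The tapes are then empty, and the
      -- registers are reset because a halting configuration must carry the initial registers.
      branch (fun r => r.col = fun _ => none)
        (push .number (fun r => (acc r.kind r.state : Bool)) <|
          load (fun _ => initial s₀) halt)
        (load (fun r => { r with state := δ r.state r.col }) <| goto fun _ => .run)
    pop .number (fun r (o : Option Bool) => ({ r with col := fun _ => none } :
      Registers S).set 0 o) <|
    pop .name (fun r (o : Option Bool) => r.set 1 o) <|
    pop .name (fun r (o : Option Bool) => r.set 2 o) <|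
    pop .name (fun r (o : Option Bool) => r.set 3 o) <|
    pop .input (fun r o => r.set 4 (o.bind symBit)) <|
    branch (fun r => isWide r.kind)
      (pop .input (fun r o => r.set 5 (o.bind symBit)) <|
        pop .input (fun r o => r.set 6 (o.bind symBit)) next)
      next

/-- `c'` is reached from `c` in exactly `t` steps. -/
def Runs (t : ℕ) (c c' : TM2.Cfg Alphabet Phase (Registers S)) : Prop :=
  (flip bind (TM2.step (program δ s₀ acc)))^[t] (some c) = some c'

variable {δ s₀ acc}

theorem Runs.refl (c : TM2.Cfg Alphabet Phase (Registers S)) : Runs δ s₀ acc 0 c c := rfl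

theorem Runs.trans {t t' : ℕ} {c c' c'' : TM2.Cfg Alphabet Phase (Registers S)}
    (h : Runs δ s₀ acc t c c') (h' : Runs δ s₀ acc t' c' c'') : Runs δ s₀ acc (t' + t) c c'' := by
  unfold Runs at *
  rw [Function.iterate_add_apply, h, h']

theorem Runs.head {t : ℕ} {c c' c'' : TM2.Cfg Alphabet Phase (Registers S)}
    (h : TM2.step (program δ s₀ acc) c = some c') (h' : Runs δ s₀ acc t c' c'') :
    Runs δ s₀ acc (t + 1) c c'' :=
  Runs.trans (t := 1) (by simpa [Runs, flip] using h) h'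

theorem runs_readNumber (n : List Bool) (m : Sym) (hm : symBit m = none) (i : List Sym)
    (nr ar n' a : List Bool) (r : Registers S) :
    Runs δ s₀ acc (n.length + 1) ⟨some .readNumber, r, tapes (bits n ++ m :: i) nr ar n' a⟩
      ⟨some .readName, { r with last := some m, kind := some m },
        tapes i (n.reverse ++ nr) ar n' a⟩ := by
  induction n generalizing nr r with
  | nil => exact Runs.head (by simp [program, bits, hm]) (Runs.refl _)
  | cons b n ih =>
    refine Runs.head (c' := ⟨some .readNumber, { r with last := some (Sym.bit b) },
      tapes (bits n ++ m :: i) (b :: nr) ar n' a⟩) (by simp [program, bits, symBit]) ?_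
    simpa using ih (b :: nr) { r with last := some (Sym.bit b) }

/-- Questions about gate types have no separator, so `i` may be empty: a failed pop ends the phase
as well. -/
theorem runs_readName (a : List Bool) (i : List Sym) (hi : ∀ m ∈ i.head?, symBit m = none)
    (nr ar n' a' : List Bool) (r : Registers S) :
    ∃ o, Runs δ s₀ acc (a.length + 1) ⟨some .readName, r, tapes (bits a ++ i) nr ar n' a'⟩
      ⟨some .reverseNumber, { r with last := o }, tapes i.tail nr (a.reverse ++ ar) n' a'⟩ := by
  induction a generalizing ar r with
  | nil =>
    refine ⟨i.head?, Runs.head ?_ (Runs.refl _)⟩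
    cases i with
    | nil => simp [program, bits]
    | cons m i => simp [program, bits, hi m (by simp)]
  | cons b a ih =>
    obtain ⟨o, ho⟩ := ih (b :: ar) { r with last := some (Sym.bit b) }
    refine ⟨o, Runs.head (c' := ⟨some .readName, { r with last := some (Sym.bit b) },
      tapes (bits a ++ i) nr (b :: ar) n' a'⟩) (by simp [program, bits, symBit]) ?_⟩
    simpa using ho

theorem runs_reverseNumber (nr : List Bool) (i : List Sym) (ar n a : List Bool) (r : Registers S) :
    Runs δ s₀ acc (nr.length + 1) ⟨some .reverseNumber, r, tapes i nr ar n a⟩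
      ⟨some .reverseName, { r with last := none }, tapes i [] ar (nr.reverse ++ n) a⟩ := by
  induction nr generalizing n r with
  | nil => exact Runs.head (by simp [program]) (Runs.refl _)
  | cons b nr ih =>
    refine Runs.head (c' := ⟨some .reverseNumber, { r with last := some (Sym.bit b) },
      tapes i nr ar (b :: n) a⟩) (by simp [program, symBit]) ?_
    simpa using ih (b :: n) { r with last := some (Sym.bit b) }

theorem runs_reverseName (ar : List Bool) (i : List Sym) (nr n a : List Bool) (r : Registers S) :
    Runs δ s₀ acc (ar.length + 1) ⟨some .reverseName, r, tapes i nr ar n a⟩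
      ⟨some .run, { r with last := none }, tapes i nr [] n (ar.reverse ++ a)⟩ := by
  induction ar generalizing a r with
  | nil => exact Runs.head (by simp [program]) (Runs.refl _)
  | cons b ar ih =>
    refine Runs.head (c' := ⟨some .reverseName, { r with last := some (Sym.bit b) },
      tapes i nr ar n (b :: a)⟩) (by simp [program, symBit]) ?_
    simpa using ih (b :: a) { r with last := some (Sym.bit b) }

theorem bits_head?_bind (b : List Bool) : (bits b).head?.bind symBit = b.head? := by
  cases b <;> rfl

theorem bits_tail (b : List Bool) : (bits b).tail = bits b.tail := by
  cases b <;> rfl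

theorem step_run (n a b : List Bool) (r : Registers S) :
    TM2.step (program δ s₀ acc) ⟨some .run, r, tapes (bits b) [] [] n a⟩ =
      if n = [] ∧ a = [] ∧ b = [] then
        some ⟨none, initial s₀, tapes [] [] [] [acc r.kind r.state] []⟩
      else some ⟨some .run,
        { r with
          col := headColumn (isWide r.kind) n a b
          state := δ r.state (headColumn (isWide r.kind) n a b) },
        tapes (bits (dropBlock (isWide r.kind) b)) [] [] n.tail a.tail.tail.tail⟩ := by
  by_cases h : n = [] ∧ a = [] ∧ b = []
  · have hn := (headColumn_eq_none_iff (isWide r.kind) n a b).2 h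
    rw [if_pos h]
    obtain ⟨rfl, rfl, rfl⟩ := h
    cases hw : isWide r.kind <;> rw [hw] at hn <;>
      simp only [headColumn, List.head?_nil, List.tail_nil, ite_self] at hn <;>
      simp [program, hw, Registers.set_narrow, Registers.set_wide, bits] <;>
      simp [hn]
  · have hn := (headColumn_eq_none_iff (isWide r.kind) n a b).not.2 h
    rw [if_neg h]
    cases hw : isWide r.kind <;> rw [hw] at hn <;>
      simp only [headColumn, Bool.false_eq_true, if_false, if_true] at hn <;>
      simp [program, hw, Registers.set_narrow, Registers.set_wide, bits_tail, bits_head?_bind,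
        headColumn, dropBlock, -List.head?_tail, decide_eq_false hn]

theorem runs_run (n a b : List Bool) (r : Registers S) :
    Runs δ s₀ acc ((columns (isWide r.kind) n a b).length + 1)
      ⟨some .run, r, tapes (bits b) [] [] n a⟩
      ⟨none, initial s₀, tapes [] [] []
        [acc r.kind ((columns (isWide r.kind) n a b).foldl δ r.state)] []⟩ := by
  obtain ⟨w, hw⟩ : ∃ w, w = isWide r.kind := ⟨_, rfl⟩
  rw [← hw]
  induction n, a, b using columns.induct w generalizing r with
  | case1 n a b h =>
    obtain ⟨rfl, rfl, rfl⟩ := h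
    rw [columns_nil]
    exact Runs.head (by rw [step_run, if_pos ⟨rfl, rfl, rfl⟩]; rfl) (Runs.refl _)
  | case2 n a b h ih =>
    rw [columns_cons w h]
    refine Runs.head (by rw [step_run, if_neg h]) ?_
    rw [← hw]
    exact ih { r with
          col := headColumn w n a b
          state := δ r.state (headColumn w n a b) } hw

variable (δ s₀ acc) in
/-- The machine. -/
noncomputable def machine [Fintype S] : FinTM2 where
  K := Stack
  k₀ := .input
  k₁ := .number
  Γ := Alphabet
  Λ := Phase
  main := .readNumber
  σ := Registers S
  initialState := initial s₀
  Γk₀Fin := inferInstanceAs (Fintype Sym)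
  m := program δ s₀ acc

end QueryMachine

/-- The symbol that tells the kind of a question. -/
def Question.kind : Question → Sym
  | gate t _ => .gate t
  | input _ _ => .input
  | output _ _ => .output
  | wire _ _ => .wire

/-- The name with which a question begins. -/
def Question.name : Question → List Bool
  | gate _ a => a
  | input a _ => a
  | output a _ => a
  | wire a _ => a

/-- The second argument of a question. -/
def Question.second : Question → List Bool
  | gate _ _ => []
  | input _ i => Computability.encodeNat i
  | output _ j => Computability.encodeNat j
  | wire _ b => b

/-- The word over the alphabet of columns for a query. -/
def Query.columns (q : Query) : List Column :=
  ThresholdCircuit.columns (QueryMachine.isWide (some q.question.kind))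
      (Computability.encodeNat q.N)
    q.question.name q.question.second

theorem Question.encode_eq (q : Question) : ∃ l, q.encode = q.kind :: (bits q.name ++ l) ∧
    (∀ m ∈ l.head?, QueryMachine.symBit m = none) ∧ l.tail = bits q.second := by
  cases q
  · exact ⟨[], by simp [encode, kind, name], by simp, rfl⟩
  all_goals exact ⟨_, rfl, by simp [QueryMachine.symBit], rfl⟩

open QueryMachine in
/-- A decision problem about queries that a finite automaton solves on the words of columns is
solved by a multistack machine in linear time. -/
theorem exists_linearTime_machine {S : Type} [Fintype S] (δ : S → Column → S) (s₀ : S)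
    (acc : Option Sym → S → Bool) (f : Query → Bool)
    (hf : ∀ q, f q = acc (some q.question.kind) (q.columns.foldl δ s₀)) :
    ∃ (T : TM2ComputableInTime Query.encode Computability.encodeBool f) (c : ℕ),
      ∀ l, T.time l ≤ c * (l + 1) := by
  -- There are five phases, each taking at most one step more than the length of the query.
  suffices h : ∀ q : Query, ∃ t, t ≤ 5 * (q.encode.length + 1) ∧
      Runs δ s₀ acc t ⟨some .readNumber, initial s₀, tapes q.encode [] [] [] []⟩
        ⟨none, initial s₀, tapes [] [] [] [f q] []⟩ by
    refine ⟨{ tm := machine δ s₀ acc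
              inputAlphabet := Equiv.refl _
              outputAlphabet := Equiv.refl _
              time := fun l => 5 * (l + 1)
              outputsFun := fun q => ⟨⟨(h q).choose, ?_⟩, (h q).choose_spec.1⟩ }, 5,
                fun l => le_rfl⟩
    have h1 : initList (machine δ s₀ acc) (List.map (Equiv.refl Sym).invFun q.encode) =
        ⟨some .readNumber, initial s₀, tapes q.encode [] [] [] []⟩ := by
      refine congrArg (TM2.Cfg.mk _ _) (funext fun k => ?_)
      cases k
      · exact List.map_id q.encode
      all_goals rfl
    have h2 : haltList (machine δ s₀ acc)
        (List.map (Equiv.refl Bool).invFun (Computability.encodeBool (f q))) =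
        ⟨none, initial s₀, tapes [] [] [] [f q] []⟩ := by
      refine congrArg (TM2.Cfg.mk _ _) (funext fun k => ?_)
      cases k <;> rfl
    have h3 := (h q).choose_spec.2
    erw [h1, Option.map_some, h2]
    exact h3
  intro q
  obtain ⟨l, hl, hm, ht⟩ := q.question.encode_eq
  have e : q.encode = bits (Computability.encodeNat q.N) ++
      q.question.kind :: (bits q.question.name ++ l) := by rw [Query.encode, hl]
  have hk : symBit q.question.kind = none := by cases q.question <;> rfl
  have h1 := runs_readNumber (δ := δ) (s₀ := s₀) (acc := acc) (Computability.encodeNat q.N)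
    q.question.kind hk (bits q.question.name ++ l) [] [] [] [] (initial s₀)
  obtain ⟨o, h2⟩ := runs_readName (δ := δ) (s₀ := s₀) (acc := acc) q.question.name l hm
    ((Computability.encodeNat q.N).reverse ++ []) [] [] []
    { initial s₀ with last := some q.question.kind, kind := some q.question.kind }
  have h3 := runs_reverseNumber (δ := δ) (s₀ := s₀) (acc := acc)
    ((Computability.encodeNat q.N).reverse ++ []) l.tail (q.question.name.reverse ++ []) [] []
    { initial s₀ with last := o, kind := some q.question.kind }
  have h4 := runs_reverseName (δ := δ) (s₀ := s₀) (acc := acc)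
    (q.question.name.reverse ++ []) l.tail []
      (((Computability.encodeNat q.N).reverse ++ []).reverse ++ [])
    [] { initial s₀ with last := none, kind := some q.question.kind }
  rw [ht] at h2 h3 h4
  have h5 := runs_run (δ := δ) (s₀ := s₀) (acc := acc)
    (((Computability.encodeNat q.N).reverse ++ []).reverse ++ [])
    ((q.question.name.reverse ++ []).reverse ++ []) q.question.second
    { initial s₀ with last := none, kind := some q.question.kind }
  simp only [List.append_nil, List.reverse_reverse, List.length_reverse] at h1 h2 h3 h4 h5
  rw [hf q, e]
  refine ⟨_, ?_, (((h1.trans h2).trans h3).trans h4).trans h5⟩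
  have h6 := length_columns_le (isWide (some q.question.kind)) (Computability.encodeNat q.N)
    q.question.name q.question.second
  have h7 : q.encode.length = (Computability.encodeNat q.N).length + 1 +
      q.question.name.length + l.length := by
    rw [e]; simp [bits]; omega
  have h8 : q.question.second.length = l.length - 1 := by
    have := congrArg List.length ht
    simpa [bits] using this.symm
  rw [← e]
  omega

end ThresholdCircuit

namespace ThresholdCircuit

/-! ### Formulas of linear arithmetic and finite automata -/

/-- Boolean combinations of the comparisons `vᵢ + c ≤ vⱼ` and `vᵢ = c` between seven natural
numbers. -/
inductive Formula
  | le (i : Fin 7) (c : ℕ) (j : Fin 7)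
  | eq (i : Fin 7) (c : ℕ)
  | not (φ : Formula)
  | and (φ ψ : Formula)

namespace Formula

/-- The truth value of a formula. -/
def Holds (v : Fin 7 → ℕ) : Formula → Prop
  | le i c j => v i + c ≤ v j
  | eq i c => v i = c
  | not φ => ¬ φ.Holds v
  | and φ ψ => φ.Holds v ∧ ψ.Holds v

/-- The disjunction of two formulas. -/
def or (φ ψ : Formula) : Formula := .not (.and (.not φ) (.not ψ))

theorem holds_or (v : Fin 7 → ℕ) (φ ψ : Formula) :
    (φ.or ψ).Holds v ↔ φ.Holds v ∨ ψ.Holds v := by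
  simp only [or, Holds]; tauto

/-- The disjunction of a list of formulas. -/
def any : List Formula → Formula
  | [] => .le 0 1 0
  | φ :: l => .or φ (any l)

theorem holds_any (v : Fin 7 → ℕ) (l : List Formula) :
    (any l).Holds v ↔ ∃ φ ∈ l, φ.Holds v := by
  induction l with
  | nil => simp [any, Holds]
  | cons φ l ih => simp [any, holds_or, ih]

end Formula

/-- The digit that an entry of a column contributes; blanks count as 0. -/
def digit (o : Option Bool) : ℕ := if o = some true then 1 else 0

/-- The number whose binary digits, least significant digit first, are the entries of row `i`. -/
def row (i : Fin 7) : List Column → ℕ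
  | [] => 0
  | c :: w => digit (c i) + 2 * row i w

theorem digit_le (o : Option Bool) : digit o ≤ 1 := by unfold digit; split <;> simp

theorem row_lt (i : Fin 7) (w : List Column) : row i w < 2 ^ w.length := by
  induction w with
  | nil => simp [row]
  | cons c w ih =>
    have := digit_le (c i)
    simp only [row, List.length_cons, pow_succ]
    omega

/-- A finite family of properties closed under left derivatives is itself an automaton: state `s`
has the residual language `P s` and accepts iff the empty word satisfies it. -/
theorem isRegular_of_derivative {α S : Type} [Fintype S] (P : S → List α → Prop) (δ : S → α → S)
    (h : ∀ s a w, P s (a :: w) ↔ P (δ s a) w) (s : S) :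
    Language.IsRegular {w | P s w} := by
  refine ⟨S, inferInstance, ⟨δ, s, {s | P s []}⟩, ?_⟩
  ext w
  change w.foldl δ s ∈ {s | P s []} ↔ P s w
  induction w generalizing s with
  | nil => rfl
  | cons a w ih => rw [List.foldl_cons, ih, h]

theorem isRegular_countP {α : Type} (f : α → Bool) (c : ℕ) :
    Language.IsRegular {w : List α | w.countP f = c} := by
  -- The state is the number of hits still to come, with `none` once there have been too many.
  have h := isRegular_of_derivative (S := Option (Fin (c + 1)))
    (fun s w => ∃ r ∈ s, w.countP f = r.1)
    (fun s a => s.bind fun r => if f a then (if h : r.1 = 0 then none else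
      some ⟨r.1 - 1, by omega⟩) else some r) ?_ (some (Fin.last c))
  · simpa using h
  · rintro (_ | r) a w
    · simp
    · obtain ⟨_ | r, hr⟩ := r <;> by_cases hf : f a <;> simp [hf]

namespace Formula

/-- Comparison with a carry: d + 2x + s ≤ e + 2y holds iff x + ⌈(s + d - e)/2⌉ ≤ y, and a carry of
at most c + 1 stays within this bound. For equality with a constant, the state is what remains of
the constant after its low digits are removed. -/
theorem isRegular (φ : Formula) : Language.IsRegular {w | φ.Holds (row · w)} := by
  induction φ with
  | le i c j =>
    refine isRegular_of_derivative (S := Fin (c + 2)) (fun s w => row i w + s.1 ≤ row j w)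
      -- The 1 turns the division into rounding up and also prevents truncation, as the subtracted
      -- digit is at most 1.
      (fun s a => ⟨(s.1 + digit (a i) + 1 - digit (a j)) / 2, ?_⟩) ?_ ⟨c, by omega⟩
    · have := digit_le (a i)
      omega
    · intro s a w
      have h1 := digit_le (a i)
      have h2 := digit_le (a j)
      simp only [row]
      omega
  | eq i c =>
    have h := isRegular_of_derivative (S := Option (Fin (c + 1)))
      (fun s w => ∃ r ∈ s, row i w = r.1)
      (fun s a => s.bind fun r => if r.1 % 2 = digit (a i) then some ⟨r.1 / 2, by omega⟩ else none)
      ?_ (some (Fin.last c))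
    · simpa [Holds] using h
    · rintro (_ | r) a w
      · simp
      · have h1 := digit_le (a i)
        by_cases h : r.1 % 2 = digit (a i)
        · simp [h, row]; omega
        · simp [h, row]; omega
  | not φ ih => exact ih.compl
  | and φ ψ ih ih' => exact ih.inf ih'

end Formula

/-- A family of regular languages is recognized by one automaton with a family of sets of
accepting states. -/
theorem exists_common_automaton {ι α : Type} [Fintype ι] (L : ι → Language α)
    (h : ∀ i, (L i).IsRegular) :
    ∃ (S : Type) (_ : Fintype S) (δ : S → α → S) (s₀ : S) (acc : ι → S → Prop),
      ∀ i w, w ∈ L i ↔ acc i (w.foldl δ s₀) := by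
  classical
  choose S hS M hM using h
  -- The product automaton: only the accepting set depends on the language.
  refine ⟨∀ i, S i, inferInstance, fun s a i => (M i).step (s i) a, fun i => (M i).start,
    fun i s => s i ∈ (M i).accept, fun i w => ?_⟩
  rw [← hM i]
  have : ∀ s : ∀ i, S i, w.foldl (fun s a i => (M i).step (s i) a) s i =
      w.foldl (M i).step (s i) := by
    induction w with
    | nil => intro s; rfl
    | cons a w ih => intro s; rw [List.foldl_cons, List.foldl_cons, ih]
  change _ ↔ w.foldl (fun s a i => (M i).step (s i) a) (fun i => (M i).start) i ∈ (M i).accept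
  rw [this]
  rfl

/-! ### Names -/

/-- The name of a node with coordinates `p`, `q`, `k`: their first `l` binary digits,
interleaved. -/
def interleave : ℕ → ℕ → ℕ → ℕ → List Bool
  | 0, _, _, _ => []
  | l + 1, p, q, k => decide (p % 2 = 1) :: decide (q % 2 = 1) :: decide (k % 2 = 1) ::
      interleave l (p / 2) (q / 2) (k / 2)

theorem length_interleave (l p q k : ℕ) : (interleave l p q k).length = 3 * l := by
  induction l generalizing p q k with
  | zero => rfl
  | succ l ih => simp [interleave, ih]; omega

theorem interleave_inj {l p q k p' q' k' : ℕ} (hp : p < 2 ^ l) (hq : q < 2 ^ l) (hk : k < 2 ^ l)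
    (hp' : p' < 2 ^ l) (hq' : q' < 2 ^ l) (hk' : k' < 2 ^ l)
    (h : interleave l p q k = interleave l p' q' k') : p = p' ∧ q = q' ∧ k = k' := by
  induction l generalizing p q k p' q' k' with
  | zero => simp at *; omega
  | succ l ih =>
    simp only [pow_succ] at hp hq hk hp' hq' hk'
    simp only [interleave, List.cons.injEq, decide_eq_decide] at h
    obtain ⟨h1, h2, h3, h4⟩ := h
    have := ih (p := p / 2) (q := q / 2) (k := k / 2) (p' := p' / 2) (q' := q' / 2) (k' := k' / 2)
      (by omega) (by omega) (by omega) (by omega) (by omega) (by omega) h4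
    omega

/-- The number with the given binary digits, least significant digit first. -/
def natOfBits : List Bool → ℕ
  | [] => 0
  | b :: l => digit (some b) + 2 * natOfBits l

theorem natOfBits_encodePosNum (p : PosNum) :
    natOfBits (Computability.encodePosNum p) = p ∧
      2 ^ (Computability.encodePosNum p).length ≤ 2 * (p : ℕ) ∧
      (p : ℕ) < 2 ^ (Computability.encodePosNum p).length := by
  induction p with
  | one => simp [Computability.encodePosNum, natOfBits, digit]
  | bit0 p ih =>
    simp [Computability.encodePosNum, natOfBits, digit, pow_succ]; omega
  | bit1 p ih =>
    simp [Computability.encodePosNum, natOfBits, digit, pow_succ]; omega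

theorem natOfBits_encodeNat (n : ℕ) : natOfBits (Computability.encodeNat n) = n := by
  unfold Computability.encodeNat
  conv_rhs => rw [← Num.to_of_nat n]
  cases (n : Num) with
  | zero => rfl
  | pos p => exact (natOfBits_encodePosNum p).1

theorem lt_two_pow_length_encodeNat (n : ℕ) : n < 2 ^ (Computability.encodeNat n).length := by
  unfold Computability.encodeNat
  conv_lhs => rw [← Num.to_of_nat n]
  cases (n : Num) with
  | zero => simp [Computability.encodeNum]
  | pos p => exact (natOfBits_encodePosNum p).2.2

theorem length_encodeNat_le (n : ℕ) : (Computability.encodeNat n).length ≤ Nat.log 2 n + 1 := by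
  rcases Nat.eq_zero_or_pos n with rfl | hn
  · simp [Computability.encodeNat, Computability.encodeNum]
  · have h : 2 ^ (Computability.encodeNat n).length ≤ 2 * n := by
      unfold Computability.encodeNat
      conv_rhs => rw [← Num.to_of_nat n]
      have hn' : (n : Num) ≠ 0 := by
        intro h
        have := Num.to_of_nat n
        rw [h] at this
        simp at this
        omega
      revert hn'
      cases (n : Num) with
      | zero => intro h; exact absurd rfl h
      | pos p => intro _; exact (natOfBits_encodePosNum p).2.1
    have := Nat.lt_pow_succ_log_self (b := 2) (by norm_num) n
    have h3 : 2 ^ (Computability.encodeNat n).length < 2 ^ (Nat.log 2 n + 2) := by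
      rw [pow_succ _ (Nat.log 2 n + 1)]
      simp only [Nat.succ_eq_add_one] at this
      omega
    have := (Nat.pow_lt_pow_iff_right (by norm_num : 1 < 2)).1 h3
    omega

/-! ### The words of columns -/

section columns

variable (wide : Bool) (n a b : List Bool)

/-- The number of columns without a digit of the index. -/
def blankColumns (w : List Column) : ℕ := w.countP fun c => c 0 = none

/-- The number of columns in which the first name has no complete block. -/
def firstGaps (w : List Column) : ℕ :=
  w.countP fun c => ¬ ((c 1).isSome ∧ (c 2).isSome ∧ (c 3).isSome)

/-- The number of columns in which the second name has no complete block. -/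
def secondGaps (w : List Column) : ℕ :=
  w.countP fun c => ¬ ((c 4).isSome ∧ (c 5).isSome ∧ (c 6).isSome)

theorem length_columns : (columns wide n a b).length =
    n.length + blankColumns (columns wide n a b) := by
  induction n, a, b using columns.induct wide with
  | case1 n a b h => obtain ⟨rfl, rfl, rfl⟩ := h; simp [columns_nil, blankColumns]
  | case2 n a b h ih =>
    rw [columns_cons wide h]
    cases n <;> simp [headColumn, blankColumns] at ih ⊢ <;> omega

theorem row_zero_columns : row 0 (columns wide n a b) = natOfBits n := by
  induction n, a, b using columns.induct wide with
  | case1 n a b h => obtain ⟨rfl, rfl, rfl⟩ := h; simp [columns_nil, row, natOfBits]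
  | case2 n a b h ih =>
    rw [columns_cons wide h, row, ih]
    cases n <;> simp [headColumn, natOfBits, digit]

theorem row_four_columns : row 4 (columns false n a b) = natOfBits b := by
  induction n, a, b using columns.induct false with
  | case1 n a b h => obtain ⟨rfl, rfl, rfl⟩ := h; simp [columns_nil, row, natOfBits]
  | case2 n a b h ih =>
    rw [columns_cons false h, row, ih]
    cases b <;> simp [headColumn, natOfBits, digit, dropBlock]

theorem decide_digit (x : Bool) (m : ℕ) : decide ((digit (some x) + 2 * m) % 2 = 1) = x ∧
    (digit (some x) + 2 * m) / 2 = m := by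
  cases x <;> simp [digit]; omega

theorem eq_interleave_of_firstGaps (h : firstGaps (columns wide n a b) = 0) :
    a = interleave (columns wide n a b).length (row 1 (columns wide n a b))
      (row 2 (columns wide n a b)) (row 3 (columns wide n a b)) := by
  induction n, a, b using columns.induct wide with
  | case1 n a b h' => obtain ⟨rfl, rfl, rfl⟩ := h'; simp [columns_nil, interleave]
  | case2 n a b h' ih =>
    rw [columns_cons wide h'] at h ⊢
    rcases a with _ | ⟨x, _ | ⟨y, _ | ⟨z, a⟩⟩⟩
    · simp [firstGaps, headColumn] at h
    · simp [firstGaps, headColumn] at h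
    · simp [firstGaps, headColumn] at h
    · have h1 : firstGaps (columns wide n.tail a (dropBlock wide b)) = 0 := by
        simpa [firstGaps, headColumn] using h
      have h2 := ih h1
      simp only [List.tail_cons] at h2 ⊢
      simp only [List.length_cons, row, interleave, headColumn, Matrix.cons_val, List.head?_cons,
        List.tail_cons, decide_digit]
      rw [← h2]

theorem eq_interleave_of_secondGaps (h : secondGaps (columns true n a b) = 0) :
    b = interleave (columns true n a b).length (row 4 (columns true n a b))
      (row 5 (columns true n a b)) (row 6 (columns true n a b)) := by
  induction n, a, b using columns.induct true with
  | case1 n a b h' => obtain ⟨rfl, rfl, rfl⟩ := h'; simp [columns_nil, interleave]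
  | case2 n a b h' ih =>
    rw [columns_cons true h'] at h ⊢
    rcases b with _ | ⟨x, _ | ⟨y, _ | ⟨z, b⟩⟩⟩
    · simp [secondGaps, headColumn] at h
    · simp [secondGaps, headColumn] at h
    · simp [secondGaps, headColumn] at h
    · have h1 : secondGaps (columns true n.tail a.tail.tail.tail b) = 0 := by
        simpa [secondGaps, headColumn, dropBlock] using h
      have h2 := ih h1
      simp only [dropBlock, if_true, List.tail_cons] at h2 ⊢
      simp only [List.length_cons, row, interleave, headColumn, Matrix.cons_val, List.head?_cons,
        List.tail_cons, decide_digit, if_true]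
      rw [← h2]

theorem firstGaps_interleave (l p q k : ℕ) (hn : n.length ≤ l)
    (hb : b.length ≤ if wide then 3 * l else l) :
    (columns wide n (interleave l p q k) b).length = l ∧
      firstGaps (columns wide n (interleave l p q k) b) = 0 := by
  induction l generalizing n b p q k with
  | zero =>
    obtain rfl : n = [] := List.length_eq_zero_iff.1 (by omega)
    obtain rfl : b = [] := List.length_eq_zero_iff.1 (by simpa using hb)
    simp [interleave, columns_nil, firstGaps]
  | succ l ih =>
    rw [columns_cons wide (by simp [interleave])]
    have := ih n.tail (dropBlock wide b) (p / 2) (q / 2) (k / 2) (by simp; omega)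
      (by cases wide <;> simp [dropBlock] at hb ⊢ <;> omega)
    simp only [interleave, List.tail_cons, List.length_cons, this.1, true_and]
    simpa [firstGaps, headColumn, interleave] using this.2

theorem secondGaps_interleave (l p q k p' q' k' : ℕ) (hn : n.length ≤ l) :
    secondGaps (columns true n (interleave l p q k) (interleave l p' q' k')) = 0 := by
  induction l generalizing n p q k p' q' k' with
  | zero =>
    obtain rfl : n = [] := List.length_eq_zero_iff.1 (by omega)
    simp [interleave, columns_nil, secondGaps]
  | succ l ih =>
    rw [columns_cons true (by simp [interleave])]
    have := ih n.tail (p / 2) (q / 2) (k / 2) (p' / 2) (q' / 2) (k' / 2) (by simp; omega)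
    simpa [secondGaps, headColumn, interleave, dropBlock] using this

end columns

end ThresholdCircuit

namespace ThresholdCircuit

/-! ### Uniformity from formulas -/

/-- The number of digits of the coordinates in a name. -/
def width (N : ℕ) : ℕ := (Computability.encodeNat N).length + 4

theorem lt_two_pow_width {N p : ℕ} (h : p ≤ N) : p < 2 ^ width N :=
  (h.trans_lt (lt_two_pow_length_encodeNat N)).trans_le
    (Nat.pow_le_pow_right (by norm_num) (by simp [width]))

/-- This is the reason for the four extra digits in `width`: the kind of a node must fit even when N
is small. -/
theorem lt_two_pow_width_of_lt {N k : ℕ} (h : k < 16) : k < 2 ^ width N :=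
  h.trans_le (Nat.pow_le_pow_right (n := 2) (i := 4) (by norm_num) (by simp [width]))

theorem length_encodeNat_le_width {j N : ℕ} (h : j ≤ N) :
    (Computability.encodeNat j).length ≤ width N := by
  have h1 := length_encodeNat_le j
  have h2 : Nat.log 2 j ≤ Nat.log 2 N := Nat.log_mono_right h
  have h3 : Nat.log 2 N ≤ (Computability.encodeNat N).length := by
    have := lt_two_pow_length_encodeNat N
    by_contra hc
    have := Nat.pow_log_le_add_one 2 N
    have : 2 ^ ((Computability.encodeNat N).length + 1) ≤ 2 ^ Nat.log 2 N :=
      Nat.pow_le_pow_right (by norm_num) (by omega)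
    rw [pow_succ] at this
    have : 0 < 2 ^ (Computability.encodeNat N).length := by positivity
    omega
  unfold width
  omega

/-- The words of columns that come from well-formed questions of kind `s` and satisfy `φ`. -/
def wordsOf (s : Sym) (φ : Formula) : Language Column :=
  {w | firstGaps w = 0} ⊓ ({w | blankColumns w = 4} ⊓
    ({w | (w.countP fun c => s = .wire ∧ ¬ ((c 4).isSome ∧ (c 5).isSome ∧ (c 6).isSome)) = 0} ⊓
      {w | φ.Holds (row · w)}))

theorem mem_wordsOf {s : Sym} {φ : Formula} {w : List Column} : w ∈ wordsOf s φ ↔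
    firstGaps w = 0 ∧ blankColumns w = 4 ∧ (s = .wire → secondGaps w = 0) ∧ φ.Holds (row · w) := by
  refine and_congr Iff.rfl (and_congr Iff.rfl (and_congr ?_ Iff.rfl))
  by_cases h : s = .wire <;> simp [h, secondGaps]

theorem isRegular_wordsOf (s : Sym) (φ : Formula) : (wordsOf s φ).IsRegular :=
  (isRegular_countP _ _).inf ((isRegular_countP _ _).inf ((isRegular_countP _ _).inf φ.isRegular))

section
variable {N : ℕ} {wide : Bool} {a b : List Bool}

/-- This is how an automaton checks the length of a name: all but four columns hold a digit of N and
every column holds a complete block of the name, so there are `width N` blocks. -/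
theorem name_of_columns
    (h1 : firstGaps (columns wide (Computability.encodeNat N) a b) = 0)
    (h2 : blankColumns (columns wide (Computability.encodeNat N) a b) = 4) :
    (columns wide (Computability.encodeNat N) a b).length = width N ∧
      a = interleave (width N) (row 1 (columns wide (Computability.encodeNat N) a b))
        (row 2 (columns wide (Computability.encodeNat N) a b))
        (row 3 (columns wide (Computability.encodeNat N) a b)) := by
  have h := length_columns wide (Computability.encodeNat N) a b
  rw [h2] at h
  refine ⟨h, ?_⟩
  have := eq_interleave_of_firstGaps wide _ a b h1
  rw [h] at this
  exact this

theorem columns_of_name {p q k : ℕ} (hp : p ≤ N) (hq : q ≤ N) (hk : k < 16)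
    (ha : interleave (width N) p q k = a) (hb : b.length ≤ if wide then 3 * width N else width N) :
    let w := columns wide (Computability.encodeNat N) a b
    firstGaps w = 0 ∧ blankColumns w = 4 ∧ row 1 w = p ∧ row 2 w = q ∧ row 3 w = k := by
  intro w
  subst ha
  have h := firstGaps_interleave wide (Computability.encodeNat N) b (width N) p q k
    (by simp [width]) hb
  have hl := length_columns wide (Computability.encodeNat N) (interleave (width N) p q k) b
  have h4 : blankColumns w = 4 := by
    have := h.1
    simp only [width] at this hl
    simp only [w, width]
    omega
  have hw := name_of_columns h.2 h4
  have hr : ∀ i, row i w < 2 ^ width N := fun i => h.1 ▸ row_lt i w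
  have hi := interleave_inj (lt_two_pow_width hp) (lt_two_pow_width hq) (lt_two_pow_width_of_lt hk)
    (hr 1) (hr 2) (hr 3) hw.2
  exact ⟨h.2, h4, hi.1.symm, hi.2.1.symm, hi.2.2.symm⟩

end

/-- A circuit family whose nodes are triples of numbers and whose connections are described by
formulas is DLOGTIME-uniform. -/
theorem dLogTimeUniform_of_formulas {out : ℕ → ℕ} (C : (N : ℕ) → Circuit N (out N))
    (pos : (N : ℕ) → (C N).Gate → ℕ × ℕ × ℕ) (pos_inj : ∀ N, Function.Injective (pos N))
    (pos_le : ∀ N g, (pos N g).1 ≤ N ∧ (pos N g).2.1 ≤ N ∧ (pos N g).2.2 < 16)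
    (out_le : ∀ N, out N ≤ N + 1) (gateφ : GateType → Formula) (inputφ outputφ wireφ : Formula)
    (hgate : ∀ v N t, v 0 = N → ((gateφ t).Holds v ↔
      ∃ g, pos N g = (v 1, v 2, v 3) ∧ (C N).label g = .gate t))
    (hinput : ∀ v N, v 0 = N → (inputφ.Holds v ↔ ∃ g, pos N g = (v 1, v 2, v 3) ∧
      ∃ k : Fin N, (k : ℕ) = v 4 ∧ (C N).label g = .input k))
    (houtput : ∀ v N, v 0 = N → (outputφ.Holds v ↔ ∃ k : Fin (out N), (k : ℕ) = v 4 ∧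
      pos N ((C N).output k) = (v 1, v 2, v 3)))
    (hwire : ∀ v N, v 0 = N → (wireφ.Holds v ↔ ∃ g h, pos N g = (v 1, v 2, v 3) ∧
      pos N h = (v 4, v 5, v 6) ∧ h ∈ (C N).children g)) :
    DLogTimeUniform C := by
  classical
  let name : (N : ℕ) → (C N).Gate → List Bool := fun N g =>
    interleave (width N) (pos N g).1 (pos N g).2.1 (pos N g).2.2
  have name_eq : ∀ N g p q k, pos N g = (p, q, k) → name N g = interleave (width N) p q k := by
    intro N g p q k h
    simp only [name, h]
  -- A name has 3(|N| + 4) bits, where the binary length |N| is at most log N + 1; this gives 3 log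
  -- N + 15.
  refine ⟨name, fun N g h hgh => pos_inj N ?_, ⟨15, fun N g => ?_⟩, ?_⟩
  · have h1 := pos_le N g
    have h2 := pos_le N h
    have := interleave_inj (lt_two_pow_width h1.1) (lt_two_pow_width h1.2.1)
      (lt_two_pow_width_of_lt h1.2.2) (lt_two_pow_width h2.1) (lt_two_pow_width h2.2.1)
      (lt_two_pow_width_of_lt h2.2.2) hgh
    exact Prod.ext this.1 (Prod.ext this.2.1 this.2.2)
  · have := length_encodeNat_le N
    simp only [name, length_interleave, width]
    omega
  let φ : Sym → Formula := fun s => match s with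
    | .gate t => gateφ t
    | .input => inputφ
    | .output => outputφ
    | .wire => wireφ
    | _ => .any []
  obtain ⟨S, _, δ, s₀, acc, hacc⟩ := exists_common_automaton (fun s => wordsOf s (φ s))
    fun s => isRegular_wordsOf s (φ s)
  refine exists_linearTime_machine δ s₀ (fun s σ => decide (∃ s' ∈ s, acc s' σ)) _ fun q => ?_
  simp only [directConnection, decide_eq_decide, Option.mem_some_iff, exists_eq_left', ← hacc,
    mem_wordsOf]
  obtain ⟨N, q⟩ := q
  have r0 := fun wide a b => (row_zero_columns wide (Computability.encodeNat N) a b).trans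
    (natOfBits_encodeNat N)
  have r4 := fun a i => (row_four_columns (Computability.encodeNat N) a
    (Computability.encodeNat i)).trans (natOfBits_encodeNat i)
  cases q with
  | gate t a =>
    simp only [Question.Holds, Query.columns, Question.kind, Question.name, Question.second, φ,
      QueryMachine.isWide]
    rw [hgate _ N t (r0 _ _ _)]
    constructor
    · rintro ⟨g, hg, hl⟩
      have hc := columns_of_name (wide := false) (b := []) (pos_le N g).1 (pos_le N g).2.1
        (pos_le N g).2.2 hg (by simp)
      exact ⟨hc.1, hc.2.1, by simp, g, Prod.ext hc.2.2.1.symm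
        (Prod.ext hc.2.2.2.1.symm hc.2.2.2.2.symm), hl⟩
    · rintro ⟨h1, h2, -, g, hg, hl⟩
      exact ⟨g, (name_eq _ _ _ _ _ hg).trans (name_of_columns h1 h2).2.symm, hl⟩
  | input a i =>
    simp only [Question.Holds, Query.columns, Question.kind, Question.name, Question.second, φ,
      QueryMachine.isWide]
    rw [hinput _ N (r0 _ _ _)]
    constructor
    · rintro ⟨g, hg, k, rfl, hl⟩
      have hc := columns_of_name (wide := false) (b := Computability.encodeNat k) (pos_le N g).1
        (pos_le N g).2.1 (pos_le N g).2.2 hg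
        (by simpa using length_encodeNat_le_width k.2.le)
      exact ⟨hc.1, hc.2.1, by simp, g, Prod.ext hc.2.2.1.symm
        (Prod.ext hc.2.2.2.1.symm hc.2.2.2.2.symm), k, (r4 _ _).symm, hl⟩
    · rintro ⟨h1, h2, -, g, hg, k, hk, hl⟩
      exact ⟨g, (name_eq _ _ _ _ _ hg).trans (name_of_columns h1 h2).2.symm, k,
        hk.trans (r4 _ _), hl⟩
  | output a i =>
    simp only [Question.Holds, Query.columns, Question.kind, Question.name, Question.second, φ,
      QueryMachine.isWide]
    rw [houtput _ N (r0 _ _ _)]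
    constructor
    · rintro ⟨k, rfl, hg⟩
      have hp := pos_le N ((C N).output k)
      have hc := columns_of_name (wide := false) (b := Computability.encodeNat k) hp.1 hp.2.1 hp.2.2
        hg (by simpa using length_encodeNat_le_width (by have := k.2; have := out_le N; omega))
      exact ⟨hc.1, hc.2.1, by simp, k, (r4 _ _).symm, Prod.ext hc.2.2.1.symm
        (Prod.ext hc.2.2.2.1.symm hc.2.2.2.2.symm)⟩
    · rintro ⟨h1, h2, -, k, hk, hg⟩
      exact ⟨k, hk.trans (r4 _ _),
        (name_eq _ _ _ _ _ hg).trans (name_of_columns h1 h2).2.symm⟩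
  | wire a b =>
    simp only [Question.Holds, Query.columns, Question.kind, Question.name, Question.second, φ,
      QueryMachine.isWide, decide_true, forall_const]
    rw [hwire _ N (r0 _ _ _)]
    constructor
    · rintro ⟨g, h, hg, hh, hc⟩
      have hp := pos_le N g
      have hp' := pos_le N h
      have hlen : b.length = 3 * width N := by rw [← hh]; simp [name, length_interleave]
      have hw := columns_of_name (wide := true) (b := b) hp.1 hp.2.1 hp.2.2 hg (by simp [hlen])
      have hgap : secondGaps (columns true (Computability.encodeNat N) a b) = 0 := by
        rw [← hg, ← hh]
        exact secondGaps_interleave _ _ _ _ _ _ _ _ (by simp [width])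
      have hl := (name_of_columns hw.1 hw.2.1).1
      have hb := eq_interleave_of_secondGaps _ _ _ hgap
      have hr : ∀ i, row i (columns true (Computability.encodeNat N) a b) < 2 ^ width N :=
        fun i => hl ▸ row_lt i _
      rw [hl] at hb
      have hi := interleave_inj (lt_two_pow_width hp'.1) (lt_two_pow_width hp'.2.1)
        (lt_two_pow_width_of_lt hp'.2.2) (hr 4) (hr 5) (hr 6) (hh.trans hb)
      exact ⟨hw.1, hw.2.1, hgap, g, h, Prod.ext hw.2.2.1.symm
        (Prod.ext hw.2.2.2.1.symm hw.2.2.2.2.symm), Prod.ext hi.1 (Prod.ext hi.2.1 hi.2.2), hc⟩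
    · rintro ⟨h1, h2, h3, g, h, hg, hh, hc⟩
      have hw := name_of_columns h1 h2
      have hb := eq_interleave_of_secondGaps _ _ _ h3
      rw [hw.1] at hb
      exact ⟨g, h, (name_eq _ _ _ _ _ hg).trans hw.2.symm,
        (name_eq _ _ _ _ _ hh).trans hb.symm, hc⟩

end ThresholdCircuit

namespace ThresholdCircuit

/-! ### Circuit families described by formulas -/

/-- The valuation that describes a pair of nodes `(p, q, k)`, `(p', q', k')` of the circuit
number `N`. -/
def env (N p q k p' q' k' : ℕ) : Fin 7 → ℕ := ![N, p, q, k, p', q', k']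

theorem eq_env (v : Fin 7 → ℕ) : v = env (v 0) (v 1) (v 2) (v 3) (v 4) (v 5) (v 6) := by
  funext i; fin_cases i <;> rfl

/-- The formula for `p' = p ∧ q' = q`. -/
def Formula.same : Formula :=
  .and (.and (.le 1 0 4) (.le 4 0 1)) (.and (.le 2 0 5) (.le 5 0 2))

/-- A description of a circuit family. The nodes of the circuit number `N` are the triples
`(p, q, k)` with `p, q ≤ N` and `k < 16`. The nodes `(p, 0, 0)` with `p < N` are the inputs, all
other nodes `(p, q, k)` are gates of type `gateType k`. A node `(p', q', k')` is a child of
`(p, q, k)` if the formula of one of the entries for `k'` in `rules k` holds. -/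
structure Design where
  gateType : Fin 16 → GateType
  rules : Fin 16 → List (Fin 16 × Formula)
  lt : ∀ k, ∀ r ∈ rules k, r.1 < k
  not_rules : ∀ k, gateType k = .not → ∃ k', rules k = [(k', .same)]

namespace Design

variable (D : Design)

/-- The nodes of a circuit. -/
abbrev Node (N : ℕ) : Type := Fin (N + 1) × Fin (N + 1) × Fin 16

/-- The connections of a circuit. -/
def IsChild (N : ℕ) (g h : Node N) : Prop :=
  ∃ r ∈ D.rules g.2.2, r.1 = h.2.2 ∧
    r.2.Holds (env N g.1 g.2.1 g.2.2 h.1 h.2.1 h.2.2)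

theorem IsChild.lt {D : Design} {N : ℕ} {g h : Node N} (hgh : D.IsChild N g h) :
    h.2.2 < g.2.2 := by
  obtain ⟨r, hr, h1, -⟩ := hgh
  exact h1 ▸ D.lt _ r hr

/-- The label of a node. -/
def label {N : ℕ} (g : Node N) : Label N :=
  if h : g.2.2 = 0 ∧ g.2.1 = 0 ∧ g.1.1 < N then .input ⟨g.1, h.2.2⟩ else .gate (D.gateType g.2.2)

open Classical in
/-- The circuit number `N`. -/
noncomputable abbrev circuit (N m : ℕ) (hm : m ≤ N + 1) (last : Fin 16) : Circuit N m where
  Gate := Node N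
  label := D.label
  children g := Finset.univ.filter (D.IsChild N g)
  output j := (⟨j, by omega⟩, 0, last)
  children_input g i h := by
    unfold label at h
    split at h
    · rename_i h0
      refine Finset.filter_eq_empty_iff.2 fun x _ hx => ?_
      exact absurd hx.lt (by simp [h0.1])
    · cases h
  card_children_not g h := by
    unfold label at h
    split at h
    · cases h
    · obtain ⟨k', hk'⟩ := D.not_rules g.2.2 (by simpa using h)
      refine Finset.card_eq_one.2 ⟨(g.1, g.2.1, k'), ?_⟩
      ext x
      simp only [IsChild, hk', Finset.mem_filter, Finset.mem_univ, true_and, List.mem_singleton,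
        exists_eq_left, Finset.mem_singleton]
      simp only [Formula.same, Formula.Holds, env, Matrix.cons_val, Prod.ext_iff, Fin.ext_iff]
      omega
  acyclic := Subrelation.wf (r := InvImage (· < ·) fun g : Node N => g.2.2)
    (fun h => (Finset.mem_filter.1 h).2.lt) (InvImage.wf _ wellFounded_lt)

theorem mem_children {N m : ℕ} {hm : m ≤ N + 1} {last : Fin 16} {g h : Node N} :
    h ∈ (D.circuit N m hm last).children g ↔ D.IsChild N g h := by
  simp [circuit]

/-- The kind drops along every wire, so the height of a node is at most its kind. -/
theorem depth_circuit_le (N m : ℕ) (hm : m ≤ N + 1) (last : Fin 16) :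
    (D.circuit N m hm last).depth ≤ 16 := by
  refine Finset.sup_le fun g _ => ?_
  suffices h : ∀ (k : ℕ) (g : Node N), g.2.2.1 = k → (D.circuit N m hm last).height g ≤ k from
    (h _ g rfl).trans g.2.2.2.le
  intro k
  induction k using Nat.strong_induction_on with
  | _ k ih =>
    intro g hg
    rw [Circuit.height_eq]
    refine Finset.sup_le fun h hh => ?_
    have := ((D.mem_children).1 hh).lt
    exact ih _ (hg ▸ this) h rfl |>.trans_lt (hg ▸ this)

/-- There are 16(N + 1)² nodes. For N = 1 these are 64, which only the additive constant can absorb,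
and the same constant serves as the exponent. -/
theorem size_circuit_le (N m : ℕ) (hm : m ≤ N + 1) (last : Fin 16) :
    (D.circuit N m hm last).size ≤ N ^ 64 + 64 := by
  have h : (D.circuit N m hm last).size = (N + 1) * ((N + 1) * 16) := by
    change Fintype.card (Node N) = _
    simp [Node]
  rw [h]
  rcases N with _ | _ | N
  · norm_num
  · norm_num
  · have h1 : N + 1 + 1 + 1 ≤ (N + 2) ^ 2 := by nlinarith
    have h2 : 16 ≤ (N + 2) ^ 4 := by
      calc 16 = 2 ^ 4 := by norm_num
        _ ≤ _ := Nat.pow_le_pow_left (by omega) 4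
    calc (N + 1 + 1 + 1) * ((N + 1 + 1 + 1) * 16)
        ≤ (N + 2) ^ 2 * ((N + 2) ^ 2 * (N + 2) ^ 4) := by gcongr
      _ = (N + 2) ^ 8 := by ring
      _ ≤ (N + 2) ^ 64 := Nat.pow_le_pow_right (by omega) (by norm_num)
      _ ≤ _ := Nat.le_add_right _ _

/-- The formula for the nodes of kind `k`. -/
def kindFormula (k : Fin 16) : Formula :=
  .and (.eq 3 k) (.and (.le 1 0 0) (.le 2 0 0))

/-- The formula for the input nodes. -/
def inputNode : Formula := .and (.eq 3 0) (.and (.eq 2 0) (.le 1 1 0))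

/-- The formula for the gates of type `t`. -/
def gateFormula (t : GateType) : Formula :=
  .and (.not inputNode)
    (.any (((List.finRange 16).filter fun k => D.gateType k = t).map kindFormula))

/-- The formula for the connections. -/
def wireFormula : Formula :=
  .and (.and (.le 4 0 0) (.le 5 0 0)) <|
    .any ((List.finRange 16).map fun k => .and (kindFormula k)
      (.any ((D.rules k).map fun r => .and (.eq 6 r.1) r.2)))

theorem dLogTimeUniform_circuit (out : ℕ → ℕ) (hout : ∀ N, out N ≤ N + 1) (last : Fin 16)
    (outφ : Formula) (houtφ : ∀ v, outφ.Holds v ↔ v 4 < out (v 0)) :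
    DLogTimeUniform fun N => D.circuit N (out N) (hout N) last := by
  refine dLogTimeUniform_of_formulas _ (fun N (g : Node N) => (g.1.1, g.2.1.1, g.2.2.1))
    (fun N g h hgh => ?_)
    (fun N (g : Node N) => ⟨Nat.lt_succ_iff.1 g.1.2, Nat.lt_succ_iff.1 g.2.1.2, g.2.2.2⟩)
    hout
    D.gateFormula (.and inputNode (.and (.le 1 0 4) (.le 4 0 1)))
    (.and (.and (.eq 3 last) (.eq 2 0)) (.and outφ (.and (.le 1 0 4) (.le 4 0 1))))
    D.wireFormula ?_ ?_ ?_ ?_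
  · simp only [Prod.mk.injEq] at hgh
    exact Prod.ext (Fin.ext hgh.1) (Prod.ext (Fin.ext hgh.2.1) (Fin.ext hgh.2.2))
  · rintro v N t rfl
    simp only [gateFormula, Formula.Holds, inputNode, Formula.holds_any, List.mem_map,
      List.mem_filter, List.mem_finRange, true_and, decide_eq_true_eq, exists_exists_and_eq_and,
      kindFormula]
    constructor
    · rintro ⟨h1, k, hk, h2, h3, h4⟩
      refine ⟨((⟨v 1, by omega⟩, ⟨v 2, by omega⟩, k) : Node (v 0)), by simp [h2], ?_⟩
      rw [label, dif_neg]
      · simp [hk]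
      · rintro ⟨rfl, h5, h6⟩
        simp [Fin.ext_iff] at h5 h6 h2
        omega
    · rintro ⟨g, hg, hl⟩
      simp only [Prod.mk.injEq] at hg
      replace hl : D.label g = _ := hl
      rw [label] at hl
      split at hl
      · cases hl
      · rename_i hn
        refine ⟨fun h => hn ?_, g.2.2, by simpa using hl, hg.2.2.symm, ?_, ?_⟩
        · refine ⟨Fin.ext ?_, Fin.ext ?_, ?_⟩
          · simpa using hg.2.2.trans h.1
          · simpa using hg.2.1.trans h.2.1
          · omega
        · have := g.1.2; omega
        · have := g.2.1.2; omega
  · rintro v N rfl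
    simp only [Formula.Holds, inputNode]
    constructor
    · rintro ⟨⟨h1, h2, h3⟩, h4, h5⟩
      refine ⟨((⟨v 1, by omega⟩, 0, 0) : Node (v 0)), by simp [h2, h1], ⟨v 4, by omega⟩, rfl, ?_⟩
      rw [label, dif_pos ⟨rfl, rfl, by simp; omega⟩]
      simp; omega
    · rintro ⟨g, hg, k, hk, hl⟩
      simp only [Prod.mk.injEq] at hg
      replace hl : D.label g = _ := hl
      rw [label] at hl
      split at hl
      · rename_i hn
        simp only [Label.input.injEq, Fin.ext_iff] at hl
        have h1 : g.2.2.1 = 0 := congrArg Fin.val hn.1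
        have h2 : g.2.1.1 = 0 := congrArg Fin.val hn.2.1
        omega
      · cases hl
  · rintro v N rfl
    simp only [Formula.Holds, houtφ]
    constructor
    · rintro ⟨⟨h1, h2⟩, h3, h4, h5⟩
      refine ⟨⟨v 4, h3⟩, rfl, ?_⟩
      simp only [Prod.mk.injEq, Fin.val_zero]
      omega
    · rintro ⟨k, hk, hg⟩
      simp only [Prod.mk.injEq, Fin.val_zero] at hg
      have := k.2
      omega
  · rintro v N rfl
    have hmem :=
      fun g h => D.mem_children (m := out (v 0)) (hm := hout _) (last := last) (g := g) (h := h)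
    simp only [wireFormula, Formula.Holds, Formula.holds_any, List.mem_map, List.mem_finRange,
      true_and, exists_exists_eq_and, kindFormula]
    constructor
    · rintro ⟨⟨h1, h2⟩, k, ⟨h3, h4, h5⟩, -, ⟨r, hr, rfl⟩, h6, h7⟩
      simp only [Formula.Holds] at h6
      refine ⟨((⟨v 1, by omega⟩, ⟨v 2, by omega⟩, k) : Node (v 0)),
        ((⟨v 4, by omega⟩, ⟨v 5, by omega⟩, r.1) : Node (v 0)), by simp [h3], by simp [h6], ?_⟩
      refine (hmem _ _).2 ⟨r, hr, rfl, ?_⟩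
      rw [eq_env v] at h7
      simpa only [h3, h6] using h7
    · rintro ⟨g, h, hg, hh, hc⟩
      obtain ⟨r, hr, h1, h2⟩ := (hmem g h).1 hc
      simp only [Prod.mk.injEq] at hg hh
      have hv : v = env (v 0) g.1 g.2.1 g.2.2 h.1 h.2.1 h.2.2 := by
        rw [hg.1, hg.2.1, hg.2.2, hh.1, hh.2.1, hh.2.2]
        exact eq_env v
      have := g.1.2
      have := g.2.1.2
      have := h.1.2
      have := h.2.1.2
      refine ⟨⟨by omega, by omega⟩, g.2.2, ⟨by omega, by omega, by omega⟩, _, ⟨r, hr, rfl⟩, ?_, ?_⟩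
      · rw [h1]; exact hh.2.2.symm
      · rw [hv]; exact h2

/-! #### Evaluation -/

section eval

variable {N m : ℕ} {hm : m ≤ N + 1} {last : Fin 16} (x : Fin N → Bool)

variable (N) in
/-- The circuit on `N` inputs with the last kind of nodes as its output. -/
noncomputable abbrev base (D : Design) : Circuit N 0 := D.circuit N 0 (Nat.zero_le _) 0

/-- The value of the node `(p, q, k)`. -/
noncomputable def val (k : Fin 16) (p q : ℕ) : Prop :=
  ∃ (hp : p < N + 1) (hq : q < N + 1), (D.base N).eval x ((⟨p, hp⟩, ⟨q, hq⟩, k) : Node N) = true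

/-- Evaluation does not look at the outputs, so all circuits of a design on N inputs share the node
values of `base`. -/
theorem eval_circuit {D : Design} (g : Node N) :
    (D.circuit N m hm last).eval x g = true ↔ D.val x g.2.2 g.1 g.2.1 :=
  ⟨fun h => ⟨g.1.2, g.2.1.2, h⟩, fun ⟨_, _, h⟩ => h⟩

open Classical in
/-- The children of kind `r.1` of a node, as pairs of numbers. -/
noncomputable def childSet (N : ℕ) (k : Fin 16) (p q : ℕ) (r : Fin 16 × Formula) : Finset (ℕ × ℕ) :=
  (Finset.range (N + 1) ×ˢ Finset.range (N + 1)).filter fun c =>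
    r.2.Holds (env N p q k c.1 c.2 r.1)

variable {D} {k : Fin 16} {p q : ℕ}

-- Rules for different kinds describe disjoint sets of children, so the counts add up. Two rules for
-- the same kind might describe the same node twice.
open Classical in
theorem card_children_filter (hr : ((D.rules k).map Prod.fst).Nodup) (hp : p < N + 1)
    (hq : q < N + 1) (P : Fin 16 → ℕ → ℕ → Prop) :
    (((D.base N).children ((⟨p, hp⟩, ⟨q, hq⟩, k) : Node N)).filter
      fun h => P h.2.2 h.1 h.2.1).card =
    ((D.rules k).map fun r => ((childSet N k p q r).filter fun c => P r.1 c.1 c.2).card).sum := by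
  have h0 : ((D.base N).children ((⟨p, hp⟩, ⟨q, hq⟩, k) : Node N)).filter
      (fun h => P h.2.2 h.1 h.2.1) = Finset.univ.filter fun h : Node N =>
        ∃ r ∈ D.rules k, r.1 = h.2.2 ∧ r.2.Holds (env N p q k h.1 h.2.1 h.2.2) ∧
          P h.2.2 h.1 h.2.1 := by
    ext h
    rw [Finset.mem_filter, D.mem_children]
    simp only [IsChild, Finset.mem_filter, Finset.mem_univ, true_and]
    constructor
    · rintro ⟨⟨r, h1, h2, h3⟩, h4⟩
      exact ⟨r, h1, h2, h3, h4⟩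
    · rintro ⟨r, h1, h2, h3, h4⟩
      exact ⟨⟨r, h1, h2, h3⟩, h4⟩
  rw [h0]
  clear h0
  generalize D.rules k = l at hr
  induction l with
  | nil => simp
  | cons r l ih =>
    rw [List.map_cons, List.nodup_cons] at hr
    rw [List.map_cons, List.sum_cons, ← ih hr.2]
    have h1 : ((childSet N k p q r).filter fun c => P r.1 c.1 c.2).card =
        (Finset.univ.filter fun h : Node N => r.1 = h.2.2 ∧
          r.2.Holds (env N p q k h.1 h.2.1 h.2.2) ∧ P h.2.2 h.1 h.2.1).card := by
      refine Finset.card_bij' (fun c _ => if hc : c.1 < N + 1 ∧ c.2 < N + 1 then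
        (⟨c.1, hc.1⟩, ⟨c.2, hc.2⟩, r.1) else (0, 0, r.1)) (fun h _ => (h.1.1, h.2.1.1)) ?_ ?_ ?_ ?_
      · rintro ⟨c, d⟩ hc
        simp only [childSet, Finset.mem_filter, Finset.mem_product, Finset.mem_range] at hc
        simp only [dif_pos hc.1.1, Finset.mem_filter, Finset.mem_univ, true_and]
        exact ⟨hc.1.2, hc.2⟩
      · rintro h hh
        simp only [Finset.mem_filter, Finset.mem_univ, true_and] at hh
        simp only [childSet, Finset.mem_filter, Finset.mem_product, Finset.mem_range]
        rw [hh.1]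
        exact ⟨⟨⟨h.1.2, h.2.1.2⟩, hh.2.1⟩, hh.2.2⟩
      · rintro ⟨c, d⟩ hc
        simp only [childSet, Finset.mem_filter, Finset.mem_product, Finset.mem_range] at hc
        simp only [dif_pos hc.1.1]
      · rintro h hh
        simp only [Finset.mem_filter, Finset.mem_univ, true_and] at hh
        rw [dif_pos ⟨h.1.2, h.2.1.2⟩, hh.1]
    rw [h1, ← Finset.card_union_of_disjoint]
    · congr 1
      ext h
      simp only [Finset.mem_filter, Finset.mem_univ, true_and, Finset.mem_union, List.mem_cons,
        exists_eq_or_imp]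
    · rw [Finset.disjoint_filter]
      rintro h - ⟨h2, -⟩ ⟨r', h3, h4, -⟩
      exact hr.1 (List.mem_map.2 ⟨r', h3, h4.trans h2.symm⟩)

theorem val_input (hp : p < N) : D.val x 0 p 0 ↔ CubeBall.One x p := by
  have hl : D.label ((⟨p, by omega⟩, 0, 0) : Node N) = .input ⟨p, hp⟩ := by
    rw [label, dif_pos ⟨rfl, rfl, hp⟩]
  have h : (D.base N).eval x ((⟨p, by omega⟩, 0, 0) : Node N) = x ⟨p, hp⟩ := by
    rw [Circuit.eval_eq]
    change (D.label _).value _ _ _ = _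
    rw [hl]
    rfl
  constructor
  · rintro ⟨h1, h2, h3⟩
    exact ⟨hp, h.symm.trans h3⟩
  · rintro ⟨h1, h2⟩
    exact ⟨by omega, by omega, h.trans h2⟩

open Classical in
theorem val_gate (hk : k ≠ 0) (hp : p < N + 1) (hq : q < N + 1) :
    D.val x k p q ↔ (D.gateType k).value
      (((D.base N).children ((⟨p, hp⟩, ⟨q, hq⟩, k) : Node N)).filter
        fun h => D.val x h.2.2 h.1 h.2.1).card
      ((D.base N).children ((⟨p, hp⟩, ⟨q, hq⟩, k) : Node N)).card = true := by
  have hl : D.label ((⟨p, hp⟩, ⟨q, hq⟩, k) : Node N) = .gate (D.gateType k) := by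
    rw [label, dif_neg fun h => hk h.1]
  have h : D.val x k p q ↔ (D.base N).eval x ((⟨p, hp⟩, ⟨q, hq⟩, k) : Node N) = true :=
    ⟨fun ⟨_, _, h⟩ => h, fun h => ⟨hp, hq, h⟩⟩
  rw [h, Circuit.eval_eq]
  change (D.label _).value _ _ _ = _ ↔ _
  rw [hl]
  simp only [← eval_circuit (m := 0) (hm := Nat.zero_le _) (last := 0) (D := D)]
  exact Iff.of_eq (by congr!)

theorem mem_children_iff (hp : p < N + 1) (hq : q < N + 1) (h : Node N) :
    h ∈ (D.base N).children ((⟨p, hp⟩, ⟨q, hq⟩, k) : Node N) ↔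
      ∃ r ∈ D.rules k, r.1 = h.2.2 ∧ r.2.Holds (env N p q k h.1 h.2.1 h.2.2) :=
  D.mem_children

theorem val_and (ht : D.gateType k = .and) (hk : k ≠ 0) (hp : p < N + 1) (hq : q < N + 1) :
    D.val x k p q ↔ ∀ r ∈ D.rules k, ∀ p' q', p' < N + 1 → q' < N + 1 →
      r.2.Holds (env N p q k p' q' r.1) → D.val x r.1 p' q' := by
  classical
  rw [val_gate x hk hp hq, ht, GateType.value, decide_eq_true_eq, Finset.card_filter_eq_iff]
  constructor
  · intro h r hr p' q' hp' hq' hh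
    exact h (⟨p', hp'⟩, ⟨q', hq'⟩, r.1) ((mem_children_iff hp hq _).2 ⟨r, hr, rfl, hh⟩)
  · intro h c hc
    obtain ⟨r, hr, h1, h2⟩ := (mem_children_iff hp hq c).1 hc
    have := h r hr c.1 c.2.1 c.1.2 c.2.1.2 (by rw [h1]; exact h2)
    rwa [h1] at this

theorem val_or (ht : D.gateType k = .or) (hk : k ≠ 0) (hp : p < N + 1) (hq : q < N + 1) :
    D.val x k p q ↔ ∃ r ∈ D.rules k, ∃ p' q', p' < N + 1 ∧ q' < N + 1 ∧
      r.2.Holds (env N p q k p' q' r.1) ∧ D.val x r.1 p' q' := by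
  classical
  rw [val_gate x hk hp hq, ht, GateType.value, decide_eq_true_eq, Finset.card_pos,
    Finset.filter_nonempty_iff]
  constructor
  · rintro ⟨c, hc, h3⟩
    obtain ⟨r, hr, h1, h2⟩ := (mem_children_iff hp hq c).1 hc
    exact ⟨r, hr, c.1, c.2.1, c.1.2, c.2.1.2, by rw [h1]; exact h2, by rw [h1]; exact h3⟩
  · rintro ⟨r, hr, p', q', hp', hq', hh, h⟩
    exact ⟨(⟨p', hp'⟩, ⟨q', hq'⟩, r.1), (mem_children_iff hp hq _).2 ⟨r, hr, rfl, hh⟩, h⟩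

theorem val_not {k' : Fin 16} (ht : D.gateType k = .not) (hr : D.rules k = [(k', .same)])
    (hk : k ≠ 0) (hp : p < N + 1) (hq : q < N + 1) : D.val x k p q ↔ ¬ D.val x k' p q := by
  classical
  have h : (D.base N).children ((⟨p, hp⟩, ⟨q, hq⟩, k) : Node N) = {(⟨p, hp⟩, ⟨q, hq⟩, k')} := by
    ext h
    rw [mem_children_iff, hr, Finset.mem_singleton]
    simp only [List.mem_singleton, exists_eq_left]
    simp only [Formula.same, Formula.Holds, env, Matrix.cons_val, Prod.ext_iff, Fin.ext_iff]
    omega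
  rw [val_gate x hk hp hq, ht, GateType.value, decide_eq_true_eq, h, Finset.card_eq_zero,
    Finset.filter_eq_empty_iff]
  simp

/-- The value of a majority gate whose children of each kind form an interval. -/
theorem val_maj (l : List (Fin 16 × ℕ × ℕ)) (ht : D.gateType k = .maj)
    (hl : List.Forall₂ (fun r e => r.1 = e.1 ∧ e.2.2 ≤ N + 1 ∧
      ∀ c d, r.2.Holds (env N p q k c d r.1) ↔ e.2.1 ≤ c ∧ c < e.2.2 ∧ d = 0) (D.rules k) l)
    (hn : (l.map Prod.fst).Nodup) (hk : k ≠ 0) (hp : p < N + 1) (hq : q < N + 1) :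
    D.val x k p q ↔ (l.map fun e => e.2.2 - e.2.1).sum <
      2 * (l.map fun e => CubeBall.cnt (D.val x e.1 · 0) e.2.1 e.2.2).sum := by
  -- An entry (k', a, b) of `l` stands for the children (c, 0, k') with a ≤ c < b.
  classical
  have hfst : (D.rules k).map Prod.fst = l.map Prod.fst := by
    clear hn
    generalize D.rules k = ρ at hl
    induction hl with
    | nil => rfl
    | cons h _ ih => simp [h.1, ih]
  have hcard : ∀ P : Fin 16 → ℕ → ℕ → Prop,
      ((D.rules k).map fun r => ((childSet N k p q r).filter fun c => P r.1 c.1 c.2).card) =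
        l.map fun e => CubeBall.cnt (P e.1 · 0) e.2.1 e.2.2 := by
    intro P
    clear hn hfst
    generalize D.rules k = ρ at hl
    induction hl with
    | nil => rfl
    | @cons r e _ _ h _ ih =>
      rw [List.map_cons, List.map_cons, ih]
      congr 1
      unfold CubeBall.cnt
      refine Finset.card_bij' (fun c _ => c.1) (fun i _ => (i, 0)) ?_ ?_ ?_ ?_
      · intro c hc
        simp only [childSet, Finset.mem_filter, h.2.2] at hc
        simp only [Finset.mem_filter, Finset.mem_Ico, ← h.1]
        refine ⟨⟨hc.1.2.1, hc.1.2.2.1⟩, ?_⟩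
        rw [← hc.1.2.2.2]
        exact hc.2
      · intro i hi
        simp only [Finset.mem_filter, Finset.mem_Ico, ← h.1] at hi
        simp only [childSet, Finset.mem_filter, Finset.mem_product, Finset.mem_range, h.2.2]
        have := h.2.1
        exact ⟨⟨⟨by omega, by omega⟩, hi.1.1, hi.1.2, trivial⟩, hi.2⟩
      · intro c hc
        simp only [childSet, Finset.mem_filter, h.2.2] at hc
        exact Prod.ext rfl hc.1.2.2.2.symm
      · intro i _
        rfl
  have h1 := card_children_filter (D := D) (k := k) (hfst ▸ hn) hp hq (D.val x)
  have h2 := card_children_filter (D := D) (k := k) (hfst ▸ hn) hp hq fun _ _ _ => True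
  rw [hcard (D.val x)] at h1
  rw [hcard fun _ _ _ => True] at h2
  rw [val_gate x hk hp hq, ht, GateType.value, decide_eq_true_eq, h1]
  simp only [Finset.filter_true] at h2
  rw [h2]
  simp only [CubeBall.cnt_true fun _ _ _ => trivial]

end eval

end Design

end ThresholdCircuit

/-! ### The concrete circuits for ψ and its inverse -/

namespace ThresholdCircuit

open CubeBall

namespace Formula

/-- `q' = 0` together with `φ`. -/
def unary (φ : Formula) : Formula := .and (.eq 5 0) φ

end Formula

namespace Design

/-- A circuit family for the bijection from the cube to the ball. The gates of the kinds 2 and 3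
recognize unmarked zeros, the comparisons of the kinds 7 and 8 count the unmarked zeros before and
after a coordinate. -/
def psi : Design where
  gateType k := match k with
    | 1 => .not | 2 => .maj | 4 => .not | 6 => .or | 7 => .maj | 8 => .maj | 11 => .or
    | 12 => .not | 13 => .or | _ => .and
  rules k := match k with
    | 1 => [(0, .same)]
    | 2 => [(1, .unary (.and (.le 1 0 4) (.le 4 0 2)))]
    | 3 => [(2, .and (.le 4 0 1) (.and (.le 1 0 5) (.le 5 0 1)))]
    | 4 => [(3, .same)]
    | 7 => [(3, .unary (.le 4 1 1)), (5, .unary (.le 4 0 1)),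
        (4, .unary (.and (.le 1 1 4) (.le 4 1 0))), (6, .unary (.and (.le 1 1 4) (.le 4 1 0)))]
    | 8 => [(4, .unary (.le 4 1 1)), (6, .unary (.le 4 1 1)),
        (3, .unary (.and (.le 1 1 4) (.le 4 1 0))), (5, .unary (.and (.le 1 0 4) (.le 4 1 0)))]
    | 9 => [(3, .same), (7, .same)]
    | 10 => [(9, .same), (8, .same)]
    | 11 => [(10, .unary (.le 4 1 0))]
    | 12 => [(11, .same)]
    | 13 => [(0, .and .same (.le 1 1 0)), (9, .and .same (.le 1 1 0)), (12, .and .same (.le 0 0 1))]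
    | _ => []
  lt := by decide
  not_rules k h := by
    fin_cases k <;> first | exact ⟨_, rfl⟩ | cases h

/-- A circuit family for the inverse bijection. The gates of the kinds 2 to 5 recognize unmarked
zeros and ones, the comparisons of kind 8 count them. -/
def psiInv : Design where
  gateType k := match k with
    | 1 => .not | 2 => .maj | 3 => .maj | 6 => .not | 8 => .maj | 10 => .not | _ => .and
  rules k := match k with
    | 1 => [(0, .same)]
    | 2 => [(1, .unary (.and (.le 1 0 4) (.le 4 0 2)))]
    | 3 => [(0, .unary (.and (.le 1 0 4) (.le 4 0 2)))]
    | 4 => [(2, .and (.le 4 0 1) (.and (.le 1 0 5) (.le 5 0 1)))]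
    -- Here N = n + 1, so q' + 2 ≤ N means q' < n: the last input bit takes no part in the marking.
    | 5 => [(3, .and (.and (.le 1 0 4) (.le 4 0 1)) (.and (.le 1 0 5) (.le 5 2 0)))]
    | 6 => [(5, .same)]
    | 8 => [(4, .unary (.le 4 2 0)), (1, .unary (.and (.le 4 1 0) (.not (.le 4 2 0)))),
        (6, .unary (.le 4 1 1)), (7, .unary (.and (.le 1 0 4) (.le 4 1 0)))]
    | 9 => [(5, .same), (8, .same)]
    | 10 => [(9, .same)]
    | 11 => [(0, .same), (10, .same)]
    | _ => []
  lt := by decide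
  not_rules k h := by
    fin_cases k <;> first | exact ⟨_, rfl⟩ | cases h

theorem holds_same {N p q k p' q' k' : ℕ} :
    Formula.same.Holds (env N p q k p' q' k') ↔ p' = p ∧ q' = q := by
  simp only [Formula.same, Formula.Holds, env, Matrix.cons_val]
  omega

section psi

variable {N : ℕ} (x : Fin N → Bool) {i j : ℕ}

theorem psi_val_one (hi : i < N) : psi.val x 1 i 0 ↔ Zero x i := by
  rw [val_not x (k' := 0) rfl rfl (by decide) (by omega) (by omega), val_input x hi]
  exact ⟨fun h => (one_or_zero x hi).resolve_left h, fun h h' => h'.not_zero h⟩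

theorem psi_val_two (hij : i ≤ j) (hj : j < N) :
    psi.val x 2 i j ↔ cnt (One x) i (j + 1) < cnt (Zero x) i (j + 1) := by
  rw [val_maj x [(1, i, j + 1)] rfl ?_ (by simp) (by decide) (by omega) (by omega)]
  · simp only [List.map_cons, List.map_nil, List.sum_cons, List.sum_nil, add_zero]
    rw [cnt_congr (Q := Zero x) fun l _ h => psi_val_one x (by omega)]
    have h : cnt (fun _ => True) i (j + 1) = cnt (One x) i (j + 1) + cnt (Zero x) i (j + 1) :=
      cnt_or (fun l _ h => iff_of_true trivial (one_or_zero x (by omega)))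
        fun l _ _ h => h.not_zero
    rw [cnt_true fun _ _ _ => trivial] at h
    omega
  · refine .cons ⟨rfl, by simp; omega, fun c d => ?_⟩ .nil
    simp only [Formula.unary, Formula.Holds, env, Matrix.cons_val]
    omega

/-- One conjunction over the left ends i ≤ j of the intervals ending at j implements the criterion
`IsSplit.free_zero_iff`. -/
theorem psi_val_three (hj : j < N) : psi.val x 3 j 0 ↔ FreeZero x j := by
  rw [val_and x rfl (by decide) (by omega) (by omega), FreeZero,
    (isSplit_marked x).free_zero_iff]
  change (∀ r ∈ [((2 : Fin 16), _)], _) ↔ _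
  simp only [List.mem_singleton, forall_eq, Formula.Holds, env, Matrix.cons_val]
  constructor
  · intro h
    exact ⟨hj, fun i hi => (psi_val_two x hi hj).1 (h i j (by omega) (by omega) (by omega))⟩
  · intro h i l _ _ hl
    obtain rfl : l = j := by omega
    exact (psi_val_two x (by omega) hj).2 (h.2 i (by omega))

theorem psi_val_four (hj : j < N) : psi.val x 4 j 0 ↔ ¬ FreeZero x j := by
  rw [val_not x (k' := 3) rfl rfl (by decide) (by omega) (by omega), psi_val_three x hj]

/-- Kinds without rules are constants: an empty conjunction is true and an empty disjunction is
false. They serve to shift the thresholds of majority gates. -/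
theorem psi_val_five (hj : j < N) : psi.val x 5 j 0 := by
  rw [val_and x rfl (by decide) (by omega) (by omega)]
  intro r hr
  cases hr

theorem psi_val_six (hj : j < N) : ¬ psi.val x 6 j 0 := by
  rw [val_or x rfl (by decide) (by omega) (by omega)]
  rintro ⟨r, hr, -⟩
  cases hr

theorem cnt_not_add (P : ℕ → Prop) {a b : ℕ} : cnt (fun i => ¬ P i) a b + cnt P a b = b - a := by
  rw [← cnt_true (P := fun _ => True) fun _ _ _ => trivial]
  exact (cnt_or (fun i _ _ => by tauto) fun i _ _ h => h).symm

/-- Let a and b be the numbers of unmarked zeros before and after i. The gate has 2N - 1 children,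
and i + 1 constants together with the negated bits after i make N + a - b of them true. This is a
majority iff b ≤ a. -/
theorem psi_val_seven (hi : i < N) :
    psi.val x 7 i 0 ↔ cnt (FreeZero x) (i + 1) N ≤ cnt (FreeZero x) 0 i := by
  rw [val_maj x [(3, 0, i), (5, 0, i + 1), (4, i + 1, N), (6, i + 1, N)] rfl ?_ (by simp)
    (by decide) (by omega) (by omega)]
  · simp only [List.map_cons, List.map_nil, List.sum_cons, List.sum_nil, add_zero]
    rw [cnt_congr (Q := FreeZero x) fun l _ h => psi_val_three x (by omega),
      cnt_true fun l _ h => psi_val_five x (by omega),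
      cnt_congr (a := i + 1) (Q := fun l => ¬ FreeZero x l) fun l _ h => psi_val_four x (by omega),
      cnt_false fun l _ h => psi_val_six x (by omega)]
    have := cnt_not_add (FreeZero x) (a := i + 1) (b := N)
    omega
  · refine .cons ⟨rfl, by simp; omega, fun c d => ?_⟩ <|
      .cons ⟨rfl, by simp; omega, fun c d => ?_⟩ <|
      .cons ⟨rfl, by simp, fun c d => ?_⟩ <| .cons ⟨rfl, by simp, fun c d => ?_⟩ .nil
    all_goals
      simp only [Formula.unary, Formula.Holds, env, Matrix.cons_val]
      omega

/-- The roles of the two sides are exchanged: again there are 2N - 1 children, now with N - a + b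
true ones. -/
theorem psi_val_eight (hi : i < N) :
    psi.val x 8 i 0 ↔ cnt (FreeZero x) 0 i ≤ cnt (FreeZero x) (i + 1) N := by
  rw [val_maj x [(4, 0, i), (6, 0, i), (3, i + 1, N), (5, i, N)] rfl ?_ (by simp)
    (by decide) (by omega) (by omega)]
  · simp only [List.map_cons, List.map_nil, List.sum_cons, List.sum_nil, add_zero]
    rw [cnt_congr (a := i + 1) (Q := FreeZero x) fun l _ h => psi_val_three x (by omega),
      cnt_true (a := i) (b := N) fun l _ h => psi_val_five x (by omega),
      cnt_congr (a := 0) (Q := fun l => ¬ FreeZero x l) fun l _ h => psi_val_four x (by omega),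
      cnt_false fun l _ h => psi_val_six x (by omega)]
    have := cnt_not_add (FreeZero x) (a := 0) (b := i)
    omega
  · refine .cons ⟨rfl, by simp; omega, fun c d => ?_⟩ <|
      .cons ⟨rfl, by simp; omega, fun c d => ?_⟩ <|
      .cons ⟨rfl, by simp, fun c d => ?_⟩ <| .cons ⟨rfl, by simp, fun c d => ?_⟩ .nil
    all_goals
      simp only [Formula.unary, Formula.Holds, env, Matrix.cons_val]
      omega

/-- The value of a conjunction of two nodes with the same coordinates. -/
theorem val_and_same {D : Design} {k k₁ k₂ : Fin 16} {p q : ℕ} (ht : D.gateType k = .and)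
    (hr : D.rules k = [(k₁, .same), (k₂, .same)]) (hk : k ≠ 0) (hp : p < N + 1) (hq : q < N + 1) :
    D.val x k p q ↔ D.val x k₁ p q ∧ D.val x k₂ p q := by
  rw [val_and x ht hk hp hq, hr]
  simp only [List.mem_cons, List.not_mem_nil, or_false, forall_eq_or_imp, forall_eq, holds_same]
  constructor
  · intro h
    exact ⟨h.1 p q hp hq ⟨rfl, rfl⟩, h.2 p q hp hq ⟨rfl, rfl⟩⟩
  · rintro ⟨h1, h2⟩
    exact ⟨by rintro _ _ _ _ ⟨rfl, rfl⟩; exact h1, by rintro _ _ _ _ ⟨rfl, rfl⟩; exact h2⟩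

theorem psi_val_nine (hi : i < N) :
    psi.val x 9 i 0 ↔ FreeZero x i ∧ cnt (FreeZero x) (i + 1) N ≤ cnt (FreeZero x) 0 i := by
  rw [val_and_same x (k₁ := 3) (k₂ := 7) rfl rfl (by decide) (by omega) (by omega),
    psi_val_three x hi, psi_val_seven x hi]

theorem psi_val_ten (hi : i < N) :
    psi.val x 10 i 0 ↔ FreeZero x i ∧ cnt (FreeZero x) (i + 1) N ≤ cnt (FreeZero x) 0 i ∧
      cnt (FreeZero x) 0 i ≤ cnt (FreeZero x) (i + 1) N := by
  rw [val_and_same x (k₁ := 9) (k₂ := 8) rfl rfl (by decide) (by omega) (by omega),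
    psi_val_nine x hi, psi_val_eight x hi, and_assoc]

theorem psi_val_twelve : psi.val x 12 N 0 ↔ CubeBall.psi N x (Fin.last N) = true := by
  rw [val_not x (k' := 11) rfl rfl (by decide) (by omega) (by omega), psi_last_iff,
    val_or x rfl (by decide) (by omega) (by omega)]
  change ¬ (∃ r ∈ [((10 : Fin 16), _)], _) ↔ _
  simp only [List.mem_singleton, exists_eq_left, Formula.unary, Formula.Holds, env, Matrix.cons_val]
  refine not_congr ⟨?_, ?_⟩
  · rintro ⟨p, q, hp, hq, ⟨rfl, h1⟩, h2⟩
    exact ⟨p, h1, (psi_val_ten x h1).1 h2⟩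
  · rintro ⟨p, hp, h⟩
    exact ⟨p, 0, by omega, by omega, ⟨rfl, hp⟩, (psi_val_ten x hp).2 h⟩

/-- All output bits are nodes of one kind; the side conditions p < N and N ≤ p in its rules separate
the first N bits from the appended one. -/
theorem psi_val_thirteen (j : Fin (N + 1)) : psi.val x 13 j 0 ↔ CubeBall.psi N x j = true := by
  rw [val_or x rfl (by decide) j.2 (by omega)]
  change (∃ r ∈ [((0 : Fin 16), _), (9, _), (12, _)], _) ↔ _
  simp only [List.mem_cons, List.not_mem_nil, or_false, exists_eq_or_imp, exists_eq_left]
  simp only [Formula.Holds, holds_same]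
  by_cases hj : j.1 < N
  · obtain ⟨j, hj'⟩ := j
    rw [one_psi_iff x hj]
    simp only [env, Matrix.cons_val]
    rw [← val_input x hj, ← psi_val_nine x hj]
    constructor
    · rintro (⟨p, q, -, -, ⟨⟨rfl, rfl⟩, -⟩, h⟩ | ⟨p, q, -, -, ⟨⟨rfl, rfl⟩, -⟩, h⟩ |
        ⟨p, q, -, -, ⟨-, h⟩, -⟩)
      · exact Or.inl h
      · exact Or.inr h
      · simp only at hj; omega
    · rintro (h | h)
      · exact Or.inl ⟨j, 0, hj', by omega, ⟨⟨rfl, rfl⟩, hj⟩, h⟩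
      · exact Or.inr (Or.inl ⟨j, 0, hj', by omega, ⟨⟨rfl, rfl⟩, hj⟩, h⟩)
  · obtain rfl : j = Fin.last N := Fin.ext (by simp; omega)
    rw [← psi_val_twelve]
    simp only [env, Matrix.cons_val, Fin.val_last]
    constructor
    · rintro (⟨p, q, -, -, ⟨-, h⟩, -⟩ | ⟨p, q, -, -, ⟨-, h⟩, -⟩ | ⟨p, q, -, -, ⟨⟨rfl, rfl⟩, -⟩, h⟩)
      · omega
      · omega
      · exact h
    · intro h
      exact Or.inr (Or.inr ⟨N, 0, by omega, by omega, ⟨⟨rfl, rfl⟩, by omega⟩, h⟩)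

end psi

/-! ### Gate values of the circuit for the inverse -/

section psiInv

variable {n : ℕ} (w : Fin (n + 1) → Bool) {i j : ℕ}

theorem one_castSucc (hi : i < n) : One (fun i => w (Fin.castSucc i)) i ↔ One w i :=
  ⟨fun h => ⟨hi.trans (Nat.lt_succ_self n), h.2⟩, fun h => ⟨hi, h.2⟩⟩

theorem zero_castSucc (hi : i < n) : Zero (fun i => w (Fin.castSucc i)) i ↔ Zero w i :=
  ⟨fun h => ⟨hi.trans (Nat.lt_succ_self n), h.2⟩, fun h => ⟨hi, h.2⟩⟩

theorem psiInv_val_one (hi : i < n + 1) : psiInv.val w 1 i 0 ↔ Zero w i := by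
  rw [val_not w (k' := 0) rfl rfl (by decide) (by omega) (by omega), val_input w hi]
  exact ⟨fun h => (one_or_zero w hi).resolve_left h, fun h h' => h'.not_zero h⟩

theorem cnt_one_add_cnt_zero (hj : j < n) :
    cnt (One fun i => w (Fin.castSucc i)) i (j + 1) +
      cnt (Zero fun i => w (Fin.castSucc i)) i (j + 1) = j + 1 - i := by
  rw [← cnt_true (P := fun _ => True) fun _ _ _ => trivial]
  exact (cnt_or (fun l _ h => iff_of_true trivial (one_or_zero _ (by omega)))
        fun l _ _ h => h.not_zero).symm

theorem psiInv_val_two (hij : i ≤ j) (hj : j < n) : psiInv.val w 2 i j ↔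
    cnt (One fun i => w (Fin.castSucc i)) i (j + 1) <
      cnt (Zero fun i => w (Fin.castSucc i)) i (j + 1) := by
  rw [val_maj w [(1, i, j + 1)] rfl ?_ (by simp) (by decide) (by omega) (by omega)]
  · simp only [List.map_cons, List.map_nil, List.sum_cons, List.sum_nil, add_zero]
    rw [cnt_congr (Q := Zero fun i => w (Fin.castSucc i)) fun l _ h =>
      (psiInv_val_one w (by omega)).trans (zero_castSucc w (by omega)).symm]
    have := cnt_one_add_cnt_zero w (i := i) hj
    omega
  · refine .cons ⟨rfl, by simp; omega, fun c d => ?_⟩ .nil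
    simp only [Formula.unary, Formula.Holds, env, Matrix.cons_val]
    omega

theorem psiInv_val_three (hij : i ≤ j) (hj : j < n) : psiInv.val w 3 i j ↔
    cnt (Zero fun i => w (Fin.castSucc i)) i (j + 1) <
      cnt (One fun i => w (Fin.castSucc i)) i (j + 1) := by
  rw [val_maj w [(0, i, j + 1)] rfl ?_ (by simp) (by decide) (by omega) (by omega)]
  · simp only [List.map_cons, List.map_nil, List.sum_cons, List.sum_nil, add_zero]
    rw [cnt_congr (Q := One fun i => w (Fin.castSucc i)) fun l _ h =>
      (val_input w (by omega)).trans (one_castSucc w (by omega)).symm]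
    have := cnt_one_add_cnt_zero w (i := i) hj
    omega
  · refine .cons ⟨rfl, by simp; omega, fun c d => ?_⟩ .nil
    simp only [Formula.unary, Formula.Holds, env, Matrix.cons_val]
    omega

theorem psiInv_val_four (hj : j < n) :
    psiInv.val w 4 j 0 ↔ FreeZero (fun i => w (Fin.castSucc i)) j := by
  rw [val_and w rfl (by decide) (by omega) (by omega), FreeZero,
    (isSplit_marked _).free_zero_iff]
  change (∀ r ∈ [((2 : Fin 16), _)], _) ↔ _
  simp only [List.mem_singleton, forall_eq, Formula.Holds, env, Matrix.cons_val]
  constructor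
  · intro h
    exact ⟨hj, fun i hi => (psiInv_val_two w hi hj).1 (h i j (by omega) (by omega) (by omega))⟩
  · intro h i l _ _ hl
    obtain rfl : l = j := by omega
    exact (psiInv_val_two w (by omega) hj).2 (h.2 i (by omega))

theorem psiInv_val_five (hi : i < n) :
    psiInv.val w 5 i 0 ↔ FreeOne (fun i => w (Fin.castSucc i)) i := by
  rw [val_and w rfl (by decide) (by omega) (by omega), FreeOne,
    (isSplit_marked _).free_one_iff]
  change (∀ r ∈ [((3 : Fin 16), _)], _) ↔ _
  simp only [List.mem_singleton, forall_eq, Formula.Holds, env, Matrix.cons_val]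
  constructor
  · intro h
    exact ⟨hi, fun j hij hj => (psiInv_val_three w hij hj).1
      (h i j (by omega) (by omega) (by omega))⟩
  · intro h l j _ _ hl
    obtain rfl : l = i := by omega
    exact (psiInv_val_three w (by omega) (by omega)).2 (h.2 j (by omega) (by omega))

theorem psiInv_val_six (hi : i < n) :
    psiInv.val w 6 i 0 ↔ ¬ FreeOne (fun i => w (Fin.castSucc i)) i := by
  rw [val_not w (k' := 5) rfl rfl (by decide) (by omega) (by omega), psiInv_val_five w hi]

theorem psiInv_val_seven (hi : i < n + 1) : psiInv.val w 7 i 0 := by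
  rw [val_and w rfl (by decide) (by omega) (by omega)]
  intro r hr
  cases hr

/-- With a unmarked ones before i, z unmarked zeros and e = 1 iff the last bit is 0, the gate has 2n
+ 2 children, of which z + e + (i - a) + (n + 1 - i) are true. This is a majority iff a < z + e. -/
theorem psiInv_val_eight (hi : i < n) : psiInv.val w 8 i 0 ↔
    cnt (FreeOne fun i => w (Fin.castSucc i)) 0 i <
      freeZeros (fun i => w (Fin.castSucc i)) + if w (Fin.last n) = true then 0 else 1 := by
  rw [val_maj w [(4, 0, n), (1, n, n + 1), (6, 0, i), (7, i, n + 1)] rfl ?_ (by simp)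
    (by decide) (by omega) (by omega)]
  · simp only [List.map_cons, List.map_nil, List.sum_cons, List.sum_nil, add_zero]
    rw [cnt_congr (a := 0) (b := n) (Q := FreeZero fun i => w (Fin.castSucc i))
        fun l _ h => psiInv_val_four w h,
      cnt_congr (a := n) (Q := Zero w) fun l _ h => psiInv_val_one w h,
      cnt_congr (a := 0) (b := i) (Q := fun l => ¬ FreeOne (fun i => w (Fin.castSucc i)) l)
        fun l _ h => psiInv_val_six w (by omega),
      cnt_true fun l _ h => psiInv_val_seven w h]
    have h1 := cnt_not_add (FreeOne fun i => w (Fin.castSucc i)) (a := 0) (b := i)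
    have h2 : cnt (Zero w) n (n + 1) = if w (Fin.last n) = true then 0 else 1 := by
      split_ifs with h
      · rw [cnt_succ_of_not le_rfl (One.not_zero ⟨by omega, h⟩), cnt_self]
      · rw [cnt_succ_of le_rfl ⟨by omega, Bool.eq_false_of_not_eq_true h⟩, cnt_self]
    rw [h2, freeZeros]
    omega
  · refine .cons ⟨rfl, by simp; omega, fun c d => ?_⟩ <| .cons ⟨rfl, by simp, fun c d => ?_⟩ <|
      .cons ⟨rfl, by simp; omega, fun c d => ?_⟩ <| .cons ⟨rfl, by simp, fun c d => ?_⟩ .nil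
    all_goals
      simp only [Formula.unary, Formula.Holds, env, Matrix.cons_val]
      omega

theorem psiInv_val_eleven (i : Fin n) : psiInv.val w 11 i 0 ↔ unpsi w i = true := by
  have hi := i.2
  rw [val_and_same w (k₁ := 0) (k₂ := 10) rfl rfl (by decide) (by omega) (by omega),
    val_not w (k := 10) (k' := 9) rfl rfl (by decide) (by omega) (by omega),
    val_and_same w (k := 9) (k₁ := 5) (k₂ := 8) rfl rfl (by decide) (by omega) (by omega),
    psiInv_val_five w hi, psiInv_val_eight w hi, val_input w (by omega), one_unpsi_iff]
  exact and_congr_left fun _ => ⟨fun h => h.2, fun h => ⟨by omega, h⟩⟩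

end psiInv

end Design

end ThresholdCircuit

/-! ### Membership in uniform TC⁰ and the conclusion -/

open ThresholdCircuit in
theorem inUniformTC0_psiFamily : InUniformTC0 (fun N => N + 1) CubeBall.psiFamily := by
  refine ⟨fun N => Design.psi.circuit N (N + 1) le_rfl 13, ⟨64, fun N => Design.size_circuit_le ..⟩,
    ⟨16, fun N => Design.depth_circuit_le ..⟩,
    Design.dLogTimeUniform_circuit _ (fun N => N + 1) _ 13 (.le 4 0 0) fun v => ?_, ?_⟩
  · simp only [Formula.Holds]
    omega
  · intro N x y hy
    funext j
    obtain ⟨-, rfl⟩ := hy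
    exact Bool.eq_iff_iff.2 ((Design.eval_circuit x _).trans (Design.psi_val_thirteen x j))

open ThresholdCircuit in
theorem inUniformTC0_psiInvFamily : InUniformTC0 (fun N => N - 1) CubeBall.psiInvFamily := by
  refine ⟨fun N => Design.psiInv.circuit N (N - 1) (by omega) 11,
    ⟨64, fun N => Design.size_circuit_le ..⟩,
    ⟨16, fun N => Design.depth_circuit_le ..⟩,
    -- The condition j + 2 ≤ N expresses j < N - 1 with truncated subtraction, also for N = 0.
    Design.dLogTimeUniform_circuit _ (fun N => N - 1) (by omega) 11 (.le 4 2 0) fun v => ?_, ?_⟩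
  · simp only [Formula.Holds]
    omega
  · rintro (_ | n) w y hy
    · exact absurd hy (Part.notMem_none y)
    · obtain ⟨⟨hn, hw⟩, rfl⟩ := hy
      funext j
      change _ = CubeBall.psiInv n w j
      rw [CubeBall.psiInv_eq hn hw]
      exact Bool.eq_iff_iff.2 ((Design.eval_circuit w _).trans (Design.psiInv_val_eleven w j))

theorem mainTheorem5 :
    (∀ n : ℕ, Even n → Set.BijOn (CubeBall.psi n) Set.univ (CubeBall.ball n)) ∧
    ThresholdCircuit.InUniformTC0 (fun N => N + 1) CubeBall.psiFamily ∧
    ThresholdCircuit.InUniformTC0 (fun N => N - 1) CubeBall.psiInvFamily :=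
  ⟨fun _ hn => CubeBall.bijOn_psi hn, inUniformTC0_psiFamily, inUniformTC0_psiInvFamily⟩
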